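/- Let $b\ge1$ be an integer and $0<\alpha<1$. **Exact model.** A cyclic table has $m\ge1$ buckets, indexed by $\mathbb Z_m$, each with capacity $b$. Into the empty table $n$ keys with independent, uniformly distributed hash addresses in $\mathbb Z_m$ are entered one after the other; each key is placed in the first bucket that is not full, starting from its hash address $i$ and going through $i,i+1,i+2,\dots$ cyclically. Let $U_{m,n}$ be the number of full buckets probed in an unsuccessful search in the resulting table that starts at bucket $0$, i.e. the least $k\ge0$ such that bucket $k$ is not full (this is defined when $n<bm$, hence for all large $m,n$ in the limit considered below; by symmetry the law does not depend on the starting bucket). **Infinite Poisson model.** The buckets are indexed by $\mathbb Z$, and the numbers $X_i$, $i\in\mathbb Z$, of keys with hash address $i$ are independent with $X_i\sim\mathrm{Po}(b\alpha)$. The overflow from bucket $i$ is $Q_i=\max_{j\le i}\sum_{k=j+1}^{i}(X_k-b)$, the number of keys that try bucket $i$ is $H_i=X_i+Q_{i-1}$, and bucket $i$ finally holds $\min(H_i,b)$ keys, so that it is full if and only if $H_i\ge b$. Let $U_\alpha$ be the least $k\ge0$ such that bucket $k$ is not full. **Notation.** Let $T(z)=\sum_{n\ge1}\frac{n^{n-1}}{n!}z^n$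 for $|z|\le e^{-1}$ be the tree function, $\omega=e^{2\pi \mathrm i/b}$, and for $|q|\le(e^{\alpha-1}/\alpha)^b$ and $0\le\ell\le b-1$ let $$\zeta_\ell(q)=\frac{T\bigl(\omega^\ell\alpha e^{-\alpha}q^{1/b}\bigr)}{\alpha},\qquad \zeta_\ell=\zeta_\ell(1)=\frac{T(\omega^\ell\alpha e^{-\alpha})}{\alpha},\qquad T_0(b\alpha)=\frac{b(1-\alpha)}{\prod_{\ell=1}^{b-1}(1-\zeta_\ell)},$$ where $q^{1/b}$ is any $b$-th root of $q$ (the choice only permutes $\zeta_0(q),\dots,\zeta_{b-1}(q)$). **Theorem.** Almost surely $U_\alpha$ is well defined, i.e. some bucket $k\ge0$ of the infinite table is not full. There is a $\delta>0$, depending only on $b$ and $\alpha$, with $1+\delta\le(e^{\alpha-1}/\alpha)^b$, such that the following hold. 1. For every complex $q$ with $|q|\le1+\delta$ the variable $q^{U_\alpha}$ is integrable, and the probability generating function $\psi_U(q)=\mathbb E\,q^{U_\alpha}$ satisfies, for $q\ne1$, $$\psi_U(q)=\frac{T_0(b\alpha)}{1-q}\prod_{\ell=0}^{b-1}\bigl(1-\zeta_\ell(q)\bigr).$$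 2. All moments $\mathbb E\,U_\alpha^s$, $s=0,1,2,\dots$, are finite. 3. As $m,n\to\infty$ with $n/(bm)\to\alpha$: $U_{m,n}\to U_\alpha$ in distribution; $\mathbb E\,U_{m,n}^s\to\mathbb E\,U_\alpha^s$ for every integer $s\ge0$; and $\mathbb E\,q^{U_{m,n}}\to\psi_U(q)$ uniformly for $|q|\le1+\delta$. -/

import Mathlib

open MeasureTheory ProbabilityTheory Filter Topology

/-! ### Tables, searching and inserting

`G` is the set of bucket addresses: `ZMod m` for a cyclic table with `m` buckets, or `ℤ` for a
doubly infinite table.  `Y i` is the number of keys stored in bucket `i`, and `b` is the capacity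
of a bucket, so that bucket `i` is full exactly when `Y i < b` fails. -/

/-- The number of full buckets probed in an unsuccessful search that starts at bucket `i`, that
is, the least `k` such that bucket `i + k` is not full. (The value is `0` by convention if the
search never meets a non-full bucket.) -/
noncomputable def searchCost {G : Type*} [AddMonoidWithOne G] (b : ℕ) (Y : G → ℕ) (i : G) : ℕ :=
  sInf {k : ℕ | Y (i + (k : G)) < b}

/-- Linear probing: a key with hash address `i` is stored in the first bucket that is not full
among `i, i + 1, i + 2, …`. -/
noncomputable def insertKey {G : Type*} [AddMonoidWithOne G] [DecidableEq G]
    (b : ℕ) (Y : G → ℕ) (i : G) : G → ℕ :=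
  Function.update Y (i + (searchCost b Y i : G)) (Y (i + (searchCost b Y i : G)) + 1)

/-! ### The exact model -/

/-- Bucket contents after entering, one after the other, `n` keys with hash addresses
`h 0, …, h (n - 1)` into an empty cyclic table with `m` buckets of capacity `b`. -/
noncomputable def finiteTable (b m n : ℕ) (h : Fin n → ZMod m) : ZMod m → ℕ :=
  (List.ofFn h).foldl (insertKey b) (fun _ => 0)

/-- `U_{m,n}`, as a function of the hash addresses of the `n` keys. -/
noncomputable def finiteU (b m n : ℕ) (h : Fin n → ZMod m) : ℕ :=
  searchCost b (finiteTable b m n h) 0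

/-- The `n` keys have independent uniformly distributed hash addresses. -/
noncomputable def exactModel (m n : ℕ) [NeZero m] : Measure (Fin n → ZMod m) :=
  Measure.pi fun _ => uniformOn (Set.univ : Set (ZMod m))

instance instIsProbabilityMeasureExactModel (m n : ℕ) [NeZero m] :
    IsProbabilityMeasure (exactModel m n) := by
  unfold exactModel; infer_instance

/-! ### The infinite Poisson model

`x i` is the number of keys with hash address `i`, for `i : ℤ`. -/

/-- The overflow from bucket `i`,
`Q i = max_{j ≤ i} ∑_{k = j + 1}^{i} (x k - b)`, as an extended natural number. With `j = i - N`
the sum is `∑_{k < N} x (i - k) - b N`; as `N = 0` contributes `0`, the subtraction may be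
truncated at `0`. -/
noncomputable def overflow (b : ℕ) (x : ℤ → ℕ) (i : ℤ) : ℕ∞ :=
  ⨆ N : ℕ, (((∑ k ∈ Finset.range N, x (i - (k : ℤ))) - b * N : ℕ) : ℕ∞)

/-- The number `H i = x i + Q (i - 1)` of keys that try bucket `i`. -/
noncomputable def profile (b : ℕ) (x : ℤ → ℕ) (i : ℤ) : ℕ∞ :=
  (x i : ℕ∞) + overflow b x (i - 1)

/-- The number `min (H i) b` of keys that are stored in bucket `i`. -/
noncomputable def infiniteTable (b : ℕ) (x : ℤ → ℕ) (i : ℤ) : ℕ :=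
  (min (profile b x i) (b : ℕ∞)).toNat

/-- `U_α`, as a function of the numbers `x i` of keys with hash address `i`. -/
noncomputable def infiniteU (b : ℕ) (x : ℤ → ℕ) : ℕ :=
  searchCost b (infiniteTable b x) 0

/-- The numbers of keys hashed to the buckets `i : ℤ` are independent Poisson variables with
mean `b α`. -/
noncomputable def poissonModel (b : ℕ) (α : ℝ) : Measure (ℤ → ℕ) :=
  Measure.infinitePi fun _ => poissonMeasure ((b : ℝ) * α).toNNReal

instance instIsProbabilityMeasurePoissonModel (b : ℕ) (α : ℝ) :
    IsProbabilityMeasure (poissonModel b α) := by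
  unfold poissonModel; infer_instance

/-! ### Probability generating functions -/

/-- The probability generating function `q ↦ E q ^ U` of a random variable with values in `ℕ`. -/
noncomputable def pgf {Ω : Type*} [MeasurableSpace Ω] (μ : Measure Ω) (U : Ω → ℕ) (q : ℂ) : ℂ :=
  ∫ ω, q ^ U ω ∂μ

/-! ### The tree function and the numbers `ζ_ℓ(q)` -/

/-- The tree function `T z = ∑_{n ≥ 1} n ^ (n - 1) z ^ n / n!`, which converges for
`‖z‖ ≤ exp (-1)`; the summation index is `n - 1`. -/
noncomputable def treeT (z : ℂ) : ℂ :=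
  ∑' n : ℕ, (((n : ℂ) + 1) ^ n / ((n + 1).factorial : ℂ)) * z ^ (n + 1)

/-- `ζ_ℓ(q) = T (ω ^ ℓ α exp (-α) q ^ (1/b)) / α` with `ω = exp (2 π I / b)`, where `r` stands
for the chosen `b`-th root `q ^ (1/b)`. -/
noncomputable def zetaRoot (b : ℕ) (α : ℝ) (r : ℂ) (l : ℕ) : ℂ :=
  treeT (Complex.exp (2 * (Real.pi : ℂ) * Complex.I / (b : ℂ)) ^ l *
    ((α : ℂ) * Complex.exp (-(α : ℂ)) * r)) / (α : ℂ)

/-- `T_0(b α) = b (1 - α) / ∏_{ℓ = 1}^{b - 1} (1 - ζ_ℓ)` with `ζ_ℓ = ζ_ℓ(1)`. -/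
noncomputable def tZero (b : ℕ) (α : ℝ) : ℂ :=
  (b : ℂ) * (1 - (α : ℂ)) / ∏ l ∈ Finset.Ico 1 b, (1 - zetaRoot b α 1 l)

/-! ### Full buckets of the infinite table -/

/-! Both models are read through one functional of the address counts. In the infinite table a
bucket is full exactly when some interval ending there receives at least `b` keys per bucket
(`le_profile_iff`). A cyclic table satisfies a conservation law for contents and overflows
(`IsFlow`). When the table is not completely filled, this law forces its contents to be those given
by the infinite formula applied to the periodically extended counts (`IsFlow.infiniteTable_eq`).
Hence `finiteU` is `infiniteU` of the periodic counts.

Convergence. A Chernoff bound, uniform over the exact models with `n ≤ b β m`, `β < 1`, makes an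
interval of length `L` overcrowded with probability at most `ρ ^ L`. A run of `k` full buckets
forces an overcrowded interval of length at least `k`, so all laws of `U` are bounded by a common `C
ρ ^ k`. The finite-dimensional laws converge by characteristic functions, and truncating the
intervals transfers this to the point masses of `U`. Dominated convergence then gives `∑ |p_k -
p'_k| R ^ k → 0` for some `R = 1 + δ > 1`, which contains convergence in distribution, of moments,
and of generating functions uniformly on the closed disc.

The formula. Let `F_k(z) = E[z ^ Q_{k-1}; buckets 0, …, k-1 full]`. Independence of `X_k` from the
past gives a recursion from `F_k` to `F_{k+1}`, and stationarity relates `F_0` to `F_1`. At a root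
of `z ^ b = q exp (b α (z - 1))` the recursion telescopes (`kernel_equation`): a polynomial of
degree at most `b`, with leading coefficient `c = P(bucket 0 not full)`, vanishes there. For small
`q ≠ 0` the `ζ_ℓ(q)` are `b` distinct such roots, so the polynomial factors; its value at `1` is `(1
- q) E q ^ U = c ∏ (1 - ζ_ℓ(q))`. In the variable `r` with `q = r ^ b` both sides are analytic, so
the identity extends to a disc of radius greater than `1`, and comparing derivatives at `r = 1`
gives `c = T_0(b α)`. -/

/-- Some interval of `L ≥ 1` buckets ending at `i` receives at least `b L` keys. -/
def IsFull (b : ℕ) (x : ℤ → ℕ) (i : ℤ) : Prop :=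
  ∃ L : ℕ, 1 ≤ L ∧ b * L ≤ ∑ j ∈ Finset.range L, x (i - (j : ℤ))

lemma sum_range_succ_sub (x : ℤ → ℕ) (i : ℤ) (N : ℕ) :
    ∑ j ∈ Finset.range (N + 1), x (i - (j : ℤ))
      = x i + ∑ j ∈ Finset.range N, x (i - 1 - (j : ℤ)) := by
  rw [Finset.sum_range_succ', add_comm]
  congr 1
  · simp
  · refine Finset.sum_congr rfl fun j _ => ?_
    congr 1; push_cast; ring

/-- An interval of `N` buckets ending at `i - 1`, extended by bucket `i`, is overcrowded exactly
when its surplus together with `x i` reaches `b`; a truncated surplus corresponds to the interval of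
length one. If no interval is overcrowded, the bound `b - 1` is uniform in `N` and so survives the
supremum, which also excludes infinite overflow. -/
lemma le_profile_iff {b : ℕ} (hb : 1 ≤ b) (x : ℤ → ℕ) (i : ℤ) :
    (b : ℕ∞) ≤ profile b x i ↔ IsFull b x i := by
  constructor
  · intro h
    by_contra hn
    have key : ∀ N : ℕ, x i + ((∑ k ∈ Finset.range N, x (i - 1 - (k : ℤ))) - b * N) ≤ b - 1 := by
      intro N
      by_contra hN
      have h1 : ¬ IsFull b x i := hn
      by_cases h0 : b * N ≤ ∑ k ∈ Finset.range N, x (i - 1 - (k : ℤ))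
      · refine h1 ⟨N + 1, by omega, ?_⟩
        rw [sum_range_succ_sub, mul_add]; omega
      · refine h1 ⟨1, le_rfl, ?_⟩
        simp; omega
    have hx : x i ≤ b - 1 := by simpa using key 0
    have hQ : overflow b x (i - 1) ≤ ((b - 1 - x i : ℕ) : ℕ∞) := by
      refine iSup_le fun N => ?_
      have := key N
      exact_mod_cast (by omega : (∑ k ∈ Finset.range N, x (i - 1 - (k : ℤ))) - b * N ≤ b - 1 - x i)
    have hP : profile b x i ≤ ((x i + (b - 1 - x i) : ℕ) : ℕ∞) := by
      push_cast [profile]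
      exact add_le_add le_rfl (by exact_mod_cast hQ)
    have := h.trans hP
    have : b ≤ x i + (b - 1 - x i) := by exact_mod_cast this
    omega
  · rintro ⟨L, hL, h⟩
    obtain ⟨N, rfl⟩ : ∃ N, L = N + 1 := ⟨L - 1, by omega⟩
    rw [sum_range_succ_sub, mul_add] at h
    have h1 : (((∑ k ∈ Finset.range N, x (i - 1 - (k : ℤ))) - b * N : ℕ) : ℕ∞)
        ≤ overflow b x (i - 1) :=
      le_iSup (fun N : ℕ =>
        (((∑ k ∈ Finset.range N, x (i - 1 - (k : ℤ))) - b * N : ℕ) : ℕ∞)) N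
    calc (b : ℕ∞) ≤ ((x i + ((∑ k ∈ Finset.range N, x (i - 1 - (k : ℤ))) - b * N) : ℕ) : ℕ∞) := by
          exact_mod_cast (by omega)
      _ ≤ profile b x i := by
          rw [Nat.cast_add]; exact add_le_add le_rfl h1

lemma infiniteTable_lt_iff_profile {b : ℕ} (x : ℤ → ℕ) (i : ℤ) :
    infiniteTable b x i < b ↔ profile b x i < b := by
  unfold infiniteTable
  rcases le_total (profile b x i) b with h | h
  · rw [min_eq_left h]
    obtain ⟨k, hk⟩ := ENat.ne_top_iff_exists.1 (ne_top_of_le_ne_top (ENat.natCast_ne_top b) h)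
    rw [← hk]; simp
  · rw [min_eq_right h]; simpa using h

lemma infiniteTable_lt_iff {b : ℕ} (hb : 1 ≤ b) (x : ℤ → ℕ) (i : ℤ) :
    infiniteTable b x i < b ↔ ¬ IsFull b x i := by
  rw [infiniteTable_lt_iff_profile, ← le_profile_iff hb, not_le]

/-- If the `k + 1` buckets up to `i` are all full, an interval of at least `k + 1` buckets that
ends at `i` is overcrowded. -/
lemma exists_long_overcrowded {b : ℕ} (x : ℤ → ℕ) (k : ℕ) (i : ℤ)
    (h : ∀ j < k, IsFull b x (i - (j : ℕ))) :
    ∃ L : ℕ, k ≤ L ∧ b * L ≤ ∑ j ∈ Finset.range L, x (i - (j : ℤ)) := by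
  induction k with
  | zero => exact ⟨0, le_rfl, by simp⟩
  | succ k ih =>
    obtain ⟨L, hL, hs⟩ := ih fun j hj => h j (by omega)
    rcases Nat.lt_or_ge k L with hk | hk
    · exact ⟨L, hk, hs⟩
    · obtain rfl : L = k := le_antisymm hk hL
      obtain ⟨M, hM, hs'⟩ := h L (by omega)
      refine ⟨L + M, by omega, ?_⟩
      rw [Finset.sum_range_add, mul_add]
      refine add_le_add hs (hs'.trans (Finset.sum_le_sum fun j _ => ?_))
      apply le_of_eq; congr 1; push_cast; ring

/-! ### The finite table as a periodic infinite table -/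

/-- `Y` describes the contents of the buckets, and `Q` the overflows, of a cyclic table in which
`X i` keys have hash address `i`. -/
structure IsFlow (b : ℕ) {m : ℕ} (X Y Q : ZMod m → ℕ) : Prop where
  le : ∀ i, Y i ≤ b
  balance : ∀ i, Y i + Q i = X i + Q (i - 1)
  full : ∀ i, Q i ≠ 0 → Y i = b

namespace IsFlow

variable {b m : ℕ} [NeZero m] {X Y Q : ZMod m → ℕ}

lemma sum_eq (h : IsFlow b X Y Q) : ∑ i, Y i = ∑ i, X i := by
  have h1 : ∑ i, (Y i + Q i) = ∑ i, (X i + Q (i - 1)) := Finset.sum_congr rfl fun i _ => h.balance i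
  rw [Finset.sum_add_distrib, Finset.sum_add_distrib,
    show ∑ i, Q (i - 1) = ∑ i, Q i from (Equiv.subRight (1 : ZMod m)).sum_comp Q] at h1
  omega

lemma exists_lt (h : IsFlow b X Y Q) (hX : ∑ i, X i < b * m) : ∃ i, Y i < b := by
  by_contra! hc
  have : ∑ _i : ZMod m, b ≤ ∑ i, Y i := Finset.sum_le_sum fun i _ => hc i
  rw [h.sum_eq] at this
  simp [ZMod.card] at this
  rw [mul_comm] at hX
  omega

/-- The new key passes the `s` full buckets `i, …, i + s - 1`, which raises each of their overflows
by one, and settles in bucket `i + s`. -/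
lemma insertKey (h : IsFlow b X Y Q) (hX : ∑ i, X i < b * m) (i : ZMod m) :
    ∃ Q', IsFlow b (fun g => X g + if g = i then 1 else 0) (insertKey b Y i) Q' := by
  obtain ⟨g₀, hg₀⟩ := h.exists_lt hX
  have hne : {k : ℕ | Y (i + (k : ZMod m)) < b}.Nonempty :=
    ⟨(g₀ - i).val, by simpa using hg₀⟩
  set s := searchCost b Y i with hs
  have hmem : Y (i + (s : ZMod m)) < b := Nat.sInf_mem hne
  have hmin : ∀ k < s, ¬ Y (i + (k : ZMod m)) < b := 
    fun k hk => Nat.notMem_of_lt_sInf (s := {k : ℕ | Y (i + (k : ZMod m)) < b}) hk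
  -- A search of `m` or more steps would have visited the same non-full bucket earlier, at step `s %
  -- m`. With `s < m` the positions met are distinct and can be compared through `ZMod.val`.
  have hsm : s < m := by
    by_contra! hc
    refine hmin (s % m) ((Nat.mod_lt _ (NeZero.pos m)).trans_le hc) ?_
    simpa using hmem
  have hval : ∀ (g : ZMod m) (k : ℕ), k < m → (g = i + (k : ZMod m) ↔ (g - i).val = k) := by
    intro g k hk
    constructor
    · rintro rfl
      simp [ZMod.val_natCast, Nat.mod_eq_of_lt hk]
    · rintro rfl
      simp
  have hpred : ∀ g : ZMod m, ((g - 1 - i).val < s ↔ 1 ≤ (g - i).val ∧ (g - i).val ≤ s) := by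
    intro g
    set v := (g - i).val with hv
    have hgv : g = i + (v : ZMod m) := by simp [hv]
    have hvm : v < m := ZMod.val_lt _
    rcases Nat.eq_zero_or_pos v with h0 | h0
    · have : g - 1 - i = ((m - 1 : ℕ) : ZMod m) := by
        rw [hgv, h0, Nat.cast_sub (NeZero.pos m)]; simp
      rw [this, ZMod.val_natCast, Nat.mod_eq_of_lt (by have := NeZero.pos m; omega)]
      omega
    · have : g - 1 - i = ((v - 1 : ℕ) : ZMod m) := by
        rw [hgv, Nat.cast_sub h0, Nat.cast_one]; ring
      rw [this, ZMod.val_natCast, Nat.mod_eq_of_lt (by omega)]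
      omega
  have hY : ∀ g, _root_.insertKey b Y i g = Y g + if (g - i).val = s then 1 else 0 := by
    intro g
    unfold _root_.insertKey
    rw [← hs, Function.update_apply]
    simp only [hval g s hsm]
    split_ifs with h1
    · rw [← hval g s hsm] at h1; rw [h1]
    · rfl
  refine ⟨fun g => Q g + if (g - i).val < s then 1 else 0, ⟨fun g => ?_, fun g => ?_, fun g => ?_⟩⟩
  · rw [hY]
    split_ifs with h1
    · rw [← hval g s hsm] at h1; rw [h1]; omega
    · simpa using h.le g
  · rw [hY]
    have h1 := h.balance g
    have h2 : g = i ↔ (g - i).val = 0 := by simpa using hval g 0 (NeZero.pos m)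
    simp only [hpred, h2]
    split_ifs <;> omega
  · rw [hY]
    intro hQ
    by_cases h1 : (g - i).val < s
    · rw [if_neg (by omega), add_zero]
      have := hmin _ h1
      rw [← (hval g _ (by omega)).2 rfl] at this
      exact le_antisymm (h.le g) (not_lt.1 this)
    · simp only [h1, if_false, add_zero] at hQ
      have := h.full g hQ
      rw [if_neg]
      · simpa using this
      · intro h2
        rw [← hval g s hsm] at h2
        rw [← h2] at hmem
        omega

/-- Iterating the balance equation backwards bounds every surplus by `Q j`, with equality as long as
the buckets passed are full. Going back to the nearest bucket without overflow, which exists because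
the table is not completely filled, attains the maximum. -/
lemma infiniteTable_eq (h : IsFlow b X Y Q) (hX : ∑ i, X i < b * m) (j : ℤ) :
    infiniteTable b (fun i : ℤ => X (i : ZMod m)) j = Y (j : ZMod m) := by
  have hle : ∀ (j : ℤ) (N : ℕ),
      (∑ k ∈ Finset.range N, X ((j - (k : ℤ) : ℤ) : ZMod m)) + Q ((j - (N : ℤ) : ℤ) : ZMod m)
        ≤ Q (j : ZMod m) + b * N := by
    intro j N
    induction N with
    | zero => simp
    | succ N ih =>
      rw [Finset.sum_range_succ, mul_add]
      have h1 := h.balance ((j - (N : ℤ) : ℤ) : ZMod m)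
      have h2 := h.le ((j - (N : ℤ) : ℤ) : ZMod m)
      have h3 : ((j - ((N + 1 : ℕ) : ℤ) : ℤ) : ZMod m) = ((j - (N : ℤ) : ℤ) : ZMod m) - 1 := by
        push_cast; ring
      rw [h3]; omega
  have hov : ∀ j : ℤ, overflow b (fun i : ℤ => X (i : ZMod m)) j = (Q (j : ZMod m) : ℕ∞) := by
    intro j
    refine le_antisymm (iSup_le fun N => ?_) ?_
    · have := hle j N
      exact_mod_cast (by omega :
        (∑ k ∈ Finset.range N, X ((j - (k : ℤ) : ℤ) : ZMod m)) - b * N ≤ Q (j : ZMod m))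
    · obtain ⟨g, hg⟩ := h.exists_lt hX
      have hQg : Q g = 0 := by by_contra hc; have := h.full g hc; omega
      have hex : ∃ N : ℕ, Q ((j - (N : ℤ) : ℤ) : ZMod m) = 0 :=
        ⟨((j : ZMod m) - g).val, by simpa using hQg⟩
      have hfind := Nat.find_spec hex
      have heq : ∀ N ≤ Nat.find hex,
          (∑ k ∈ Finset.range N, X ((j - (k : ℤ) : ℤ) : ZMod m)) + Q ((j - (N : ℤ) : ℤ) : ZMod m)
            = Q (j : ZMod m) + b * N := by
        intro N
        induction N with
        | zero => simp
        | succ N ih =>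
          intro hN
          have ih' := ih (by omega)
          have h0 := h.full _ (Nat.find_min hex (Nat.lt_of_succ_le hN))
          rw [Finset.sum_range_succ, mul_add]
          have h1 := h.balance ((j - (N : ℤ) : ℤ) : ZMod m)
          have h3 : ((j - ((N + 1 : ℕ) : ℤ) : ℤ) : ZMod m) = ((j - (N : ℤ) : ℤ) : ZMod m) - 1 := by
            push_cast; ring
          rw [h3]; omega
      have h4 := heq _ le_rfl
      refine le_trans ?_ (le_iSup (fun N : ℕ =>
        (((∑ k ∈ Finset.range N, X ((j - (k : ℤ) : ℤ) : ZMod m)) - b * N : ℕ) : ℕ∞)) (Nat.find hex))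
      exact_mod_cast (by omega)
  unfold infiniteTable profile
  rw [hov]
  have h1 := h.balance (j : ZMod m)
  have h2 := h.le (j : ZMod m)
  have h3 := h.full (j : ZMod m)
  have h4 : ((j - 1 : ℤ) : ZMod m) = (j : ZMod m) - 1 := by push_cast; ring
  rw [h4, ← Nat.cast_add, ← h1]
  by_cases h0 : Q (j : ZMod m) = 0
  · rw [h0, add_zero, min_eq_left (by exact_mod_cast h2), ENat.toNat_natCast]
  · rw [h3 h0, min_eq_right (by exact_mod_cast Nat.le_add_right _ _), ENat.toNat_natCast]

end IsFlow

lemma count_ofFn_eq_sum {β : Type*} [DecidableEq β] {n : ℕ} (h : Fin n → β) (g : β) :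
    (List.ofFn h).count g = ∑ k, if h k = g then 1 else 0 := by
  induction n with
  | zero => simp
  | succ n ih =>
    rw [List.ofFn_succ, List.count_cons, ih, Fin.sum_univ_succ, add_comm]
    simp [beq_iff_eq]

lemma sum_count_eq_length {β : Type*} [Fintype β] [DecidableEq β] (l : List β) :
    ∑ g, l.count g = l.length := by
  simpa using Multiset.sum_count_eq_card (s := Finset.univ) (m := (l : Multiset β))
    (fun _ _ => Finset.mem_univ _)

lemma exists_isFlow_foldl {b m : ℕ} [NeZero m] (l : List (ZMod m)) (hl : l.length ≤ b * m) :
    ∃ Q, IsFlow b (fun g => l.count g) (l.foldl (insertKey b) (fun _ => 0)) Q := by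
  induction l using List.reverseRecOn with
  | nil => exact ⟨fun _ => 0, ⟨fun _ => by simp, fun _ => by simp, fun _ h => by simp at h⟩⟩
  | append_singleton l a ih =>
    rw [List.length_append, List.length_singleton] at hl
    obtain ⟨Q, hQ⟩ := ih (by omega)
    have hsum := sum_count_eq_length l
    obtain ⟨Q', hQ'⟩ := hQ.insertKey (by omega) a
    refine ⟨Q', ?_⟩
    rw [List.foldl_append]
    convert! hQ' using 1
    funext g
    rw [List.count_append, List.count_singleton]
    congr 1
    by_cases hg : g = a
    · simp [hg]
    · simp [hg, Ne.symm hg]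

/-- The numbers of keys with hash address `i : ℤ`, read periodically. -/
def periodicCount {m n : ℕ} (h : Fin n → ZMod m) (i : ℤ) : ℕ :=
  ∑ k, if h k = (i : ZMod m) then 1 else 0

/-- From here on the two models differ only in the law of the address counts. -/
lemma finiteU_eq {b m n : ℕ} [NeZero m] (hn : n < b * m) (h : Fin n → ZMod m) :
    finiteU b m n h = infiniteU b (periodicCount h) := by
  have hlen : (List.ofFn h).length = n := List.length_ofFn
  obtain ⟨Q, hQ⟩ := exists_isFlow_foldl (b := b) (List.ofFn h) (by omega)
  have hsum := sum_count_eq_length (List.ofFn h)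
  have hx : periodicCount h = fun i : ℤ => (List.ofFn h).count (i : ZMod m) := by
    funext i; rw [count_ofFn_eq_sum]; rfl
  unfold finiteU infiniteU searchCost
  congr 1
  ext k
  simp only [Set.mem_ofPred_eq]
  rw [hx, hQ.infiniteTable_eq (by omega)]
  simp [finiteTable]

/-! ### Measurability -/

lemma measurableSet_overcrowded (b : ℕ) (i : ℤ) (L : ℕ) :
    MeasurableSet {x : ℤ → ℕ | b * L ≤ ∑ j ∈ Finset.range L, x (i - (j : ℤ))} :=
  measurableSet_le measurable_const (Finset.measurable_sum _ fun _ _ => measurable_pi_apply _)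

lemma measurableSet_isFull (b : ℕ) (i : ℤ) : MeasurableSet {x : ℤ → ℕ | IsFull b x i} := by
  have : {x : ℤ → ℕ | IsFull b x i} = ⋃ L : ℕ, ⋃ _ : 1 ≤ L,
      {x : ℤ → ℕ | b * L ≤ ∑ j ∈ Finset.range L, x (i - (j : ℤ))} := by
    ext x; simp [IsFull]
  rw [this]
  exact MeasurableSet.iUnion fun L => MeasurableSet.iUnion fun _ => measurableSet_overcrowded b i L

lemma measurableSet_allFull (b k : ℕ) :
    MeasurableSet {x : ℤ → ℕ | ∀ j < k, IsFull b x (j : ℕ)} := by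
  have : {x : ℤ → ℕ | ∀ j < k, IsFull b x (j : ℕ)} = ⋂ j : ℕ, ⋂ _ : j < k,
      {x : ℤ → ℕ | IsFull b x (j : ℕ)} := by
    ext x; simp
  rw [this]
  exact MeasurableSet.iInter fun j => MeasurableSet.iInter fun _ => measurableSet_isFull b j

lemma infiniteU_eq_sInf {b : ℕ} (hb : 1 ≤ b) (x : ℤ → ℕ) :
    infiniteU b x = sInf {k : ℕ | ¬ IsFull b x (k : ℕ)} := by
  unfold infiniteU searchCost
  simp only [infiniteTable_lt_iff hb, zero_add]

lemma isFull_of_lt_infiniteU {b : ℕ} (hb : 1 ≤ b) {x : ℤ → ℕ} {j : ℕ} (h : j < infiniteU b x) :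
    IsFull b x (j : ℕ) := by
  rw [infiniteU_eq_sInf hb] at h
  have := Nat.notMem_of_lt_sInf h
  simpa using this

lemma le_infiniteU_iff {b : ℕ} (hb : 1 ≤ b) {x : ℤ → ℕ} (hx : ∃ k : ℕ, ¬ IsFull b x (k : ℕ))
    (k : ℕ) : k ≤ infiniteU b x ↔ ∀ j < k, IsFull b x (j : ℕ) := by
  constructor
  · intro h j hj
    exact isFull_of_lt_infiniteU hb (hj.trans_le h)
  · intro h
    rw [infiniteU_eq_sInf hb]
    by_contra! hlt
    exact Nat.sInf_mem (s := {k : ℕ | ¬ IsFull b x (k : ℕ)}) hx (h _ hlt)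

lemma measurable_infiniteU {b : ℕ} (hb : 1 ≤ b) : Measurable (infiniteU b) := by
  refine measurable_of_Ici fun k => ?_
  rcases Nat.eq_zero_or_pos k with rfl | hk
  · simp
  -- The second factor removes the configurations in which every bucket from `0` on is full: there
  -- `infiniteU` is `0` by convention, although all the fullness conditions hold.
  have : infiniteU b ⁻¹' Set.Ici k = {x : ℤ → ℕ | ∀ j < k, IsFull b x (j : ℕ)} ∩
      ⋃ j : ℕ, {x : ℤ → ℕ | IsFull b x (j : ℕ)}ᶜ := by
    ext x
    simp only [Set.mem_preimage, Set.mem_Ici, Set.mem_inter_iff, Set.mem_ofPred_eq, Set.mem_iUnion,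
      Set.mem_compl_iff]
    constructor
    · intro h
      refine ⟨fun j hj => isFull_of_lt_infiniteU hb (hj.trans_le h), ?_⟩
      by_contra! hc
      rw [infiniteU_eq_sInf hb] at h
      simp [hc] at h
      omega
    · rintro ⟨h, hx⟩
      exact (le_infiniteU_iff hb hx k).2 h
  rw [this]
  exact (measurableSet_allFull b k).inter
    (MeasurableSet.iUnion fun j => (measurableSet_isFull b j).compl)

/-! ### Geometric tails -/

/-- Under `ν`, an interval of length `L` is overcrowded with probability at most `ρ ^ L`. -/
def HasGeometricTail (b : ℕ) (ρ : ℝ) (ν : Measure (ℤ → ℕ)) : Prop :=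
  ∀ (i : ℤ) (L : ℕ),
    ν {x | b * L ≤ ∑ j ∈ Finset.range L, x (i - (j : ℤ))} ≤ ENNReal.ofReal (ρ ^ L)

namespace HasGeometricTail

variable {b : ℕ} {ρ : ℝ} {ν : Measure (ℤ → ℕ)}

lemma exists_le (h : HasGeometricTail b ρ ν) (h0 : 0 ≤ ρ) (h1 : ρ < 1) (i : ℤ) (k : ℕ) :
    ν {x | ∃ L, k ≤ L ∧ b * L ≤ ∑ j ∈ Finset.range L, x (i - (j : ℤ))}
      ≤ ENNReal.ofReal (ρ ^ k * (1 - ρ)⁻¹) := by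
  have hsub : {x : ℤ → ℕ | ∃ L, k ≤ L ∧ b * L ≤ ∑ j ∈ Finset.range L, x (i - (j : ℤ))} ⊆
      ⋃ N : ℕ, {x | b * (k + N) ≤ ∑ j ∈ Finset.range (k + N), x (i - (j : ℤ))} := by
    rintro x ⟨L, hL, hx⟩
    refine Set.mem_iUnion.2 ⟨L - k, ?_⟩
    rw [Set.mem_ofPred_eq, Nat.add_sub_cancel' hL]
    exact hx
  have hsum : HasSum (fun N => ρ ^ (k + N)) (ρ ^ k * (1 - ρ)⁻¹) := by
    simp_rw [pow_add]
    exact (hasSum_geometric_of_lt_one h0 h1).mul_left _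
  calc _ ≤ _ := measure_mono hsub
    _ ≤ ∑' N : ℕ, ν {x | b * (k + N) ≤ ∑ j ∈ Finset.range (k + N), x (i - (j : ℤ))} :=
      measure_iUnion_le _
    _ ≤ ∑' N : ℕ, ENNReal.ofReal (ρ ^ (k + N)) := ENNReal.tsum_le_tsum fun N => h i (k + N)
    _ = ENNReal.ofReal (ρ ^ k * (1 - ρ)⁻¹) := by
      rw [← ENNReal.ofReal_tsum_of_nonneg (fun N => by positivity) hsum.summable, hsum.tsum_eq]

/-- The run of full buckets ending at `k - 1` forces an overcrowded interval of length at least `k`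
ending there; a union bound over its length sums a geometric series. -/
lemma allFull_le (h : HasGeometricTail b ρ ν) (h0 : 0 ≤ ρ) (h1 : ρ < 1) (k : ℕ) :
    ν {x | ∀ j < k, IsFull b x (j : ℕ)} ≤ ENNReal.ofReal (ρ ^ k * (1 - ρ)⁻¹) := by
  refine (measure_mono fun x hx => ?_).trans (h.exists_le h0 h1 ((k : ℤ) - 1) k)
  refine exists_long_overcrowded x k _ fun j hj => ?_
  have := hx (k - 1 - j) (by omega)
  rwa [show ((k - 1 - j : ℕ) : ℤ) = (k : ℤ) - 1 - (j : ℕ) by omega] at this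

lemma ae_exists_not_isFull (h : HasGeometricTail b ρ ν) (h0 : 0 ≤ ρ) (h1 : ρ < 1) :
    ∀ᵐ x ∂ν, ∃ k : ℕ, ¬ IsFull b x (k : ℕ) := by
  rw [ae_iff]
  refine le_antisymm (ge_of_tendsto' (x := atTop)
    (f := fun k : ℕ => ENNReal.ofReal (ρ ^ k * (1 - ρ)⁻¹)) ?_ fun k => ?_) bot_le
  · have := ((tendsto_pow_atTop_nhds_zero_of_lt_one h0 h1).mul_const ((1 - ρ)⁻¹))
    simpa using ENNReal.tendsto_ofReal this
  · refine (measure_mono fun x hx => ?_).trans (h.allFull_le h0 h1 k)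
    simp only [Set.mem_ofPred_eq, not_exists, not_not] at hx
    exact fun j _ => hx j

lemma allFull_real_le [IsFiniteMeasure ν] (h : HasGeometricTail b ρ ν) (h0 : 0 ≤ ρ) (h1 : ρ < 1)
    (k : ℕ) : ν.real {x | ∀ j < k, IsFull b x (j : ℕ)} ≤ (1 - ρ)⁻¹ * ρ ^ k := by
  refine ENNReal.toReal_le_of_le_ofReal ?_ ((h.allFull_le h0 h1 k).trans_eq (by rw [mul_comm]))
  have : 0 < 1 - ρ := by linarith
  positivity

lemma measure_infiniteU_eq [IsFiniteMeasure ν] (hb : 1 ≤ b) (h : HasGeometricTail b ρ ν)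
    (h0 : 0 ≤ ρ) (h1 : ρ < 1) (k : ℕ) :
    (ν.map (infiniteU b)).real {k} = ν.real {x | ∀ j < k, IsFull b x (j : ℕ)}
      - ν.real {x | ∀ j < k + 1, IsFull b x (j : ℕ)} := by
  have hsub : {x : ℤ → ℕ | ∀ j < k + 1, IsFull b x (j : ℕ)} ⊆ {x | ∀ j < k, IsFull b x (j : ℕ)} :=
    fun x hx j hj => hx j (by omega)
  rw [map_measureReal_apply (measurable_infiniteU hb) (measurableSet_singleton k),
    ← measureReal_sdiff hsub (measurableSet_allFull b _)]
  refine measureReal_congr ?_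
  filter_upwards [h.ae_exists_not_isFull h0 h1] with x hx
  refine propext ?_
  have e1 := le_infiniteU_iff hb hx k
  have e2 := le_infiniteU_iff hb hx (k + 1)
  change infiniteU b x = k ↔ (∀ j < k, IsFull b x (j : ℕ)) ∧ ¬ ∀ j < k + 1, IsFull b x (j : ℕ)
  rw [← e1, ← e2]; omega

lemma measure_infiniteU_le [IsFiniteMeasure ν] (hb : 1 ≤ b) (h : HasGeometricTail b ρ ν)
    (h0 : 0 ≤ ρ) (h1 : ρ < 1) (k : ℕ) :
    (ν.map (infiniteU b)).real {k} ≤ (1 - ρ)⁻¹ * ρ ^ k := by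
  rw [h.measure_infiniteU_eq hb h0 h1]
  exact (sub_le_self _ measureReal_nonneg).trans (h.allFull_real_le h0 h1 k)

end HasGeometricTail

/-! ### Truncation -/

/-- Some interval of `L` buckets ending at `i`, `1 ≤ L ≤ M`, receives at least `b L` keys. -/
def IsFullWithin (b M : ℕ) (x : ℤ → ℕ) (i : ℤ) : Prop :=
  ∃ L : ℕ, 1 ≤ L ∧ L ≤ M ∧ b * L ≤ ∑ j ∈ Finset.range L, x (i - (j : ℤ))

/-- Extension by `0` of a configuration on a finite set of buckets. -/
def extendZero {W : Finset ℤ} (y : W → ℕ) (i : ℤ) : ℕ := if h : i ∈ W then y ⟨i, h⟩ else 0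

lemma isFullWithin_extendZero {b M : ℕ} {W : Finset ℤ} (x : ℤ → ℕ) (i : ℤ)
    (hW : ∀ j : ℕ, j < M → i - (j : ℤ) ∈ W) :
    IsFullWithin b M (extendZero (W.restrict x)) i ↔ IsFullWithin b M x i := by
  unfold IsFullWithin
  refine exists_congr fun L => and_congr_right fun _ => and_congr_right fun hL => ?_
  have : ∑ j ∈ Finset.range L, extendZero (W.restrict x) (i - (j : ℤ))
      = ∑ j ∈ Finset.range L, x (i - (j : ℤ)) := by
    refine Finset.sum_congr rfl fun j hj => ?_
    simp [extendZero, hW j ((Finset.mem_range.1 hj).trans_le hL)]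
  rw [this]

lemma measurableSet_allFullWithin (b M k : ℕ) :
    MeasurableSet {x : ℤ → ℕ | ∀ j < k, IsFullWithin b M x (j : ℕ)} := by
  have : {x : ℤ → ℕ | ∀ j < k, IsFullWithin b M x (j : ℕ)} = ⋂ j : ℕ, ⋂ _ : j < k,
      ⋃ L : ℕ, ⋃ _ : 1 ≤ L ∧ L ≤ M,
      {x : ℤ → ℕ | b * L ≤ ∑ l ∈ Finset.range L, x (j - (l : ℤ))} := by
    ext x; simp [IsFullWithin, and_assoc]
  rw [this]
  exact MeasurableSet.iInter fun j => MeasurableSet.iInter fun _ =>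
    MeasurableSet.iUnion fun L => MeasurableSet.iUnion fun _ =>
      measurableSet_overcrowded b j L

/-- The two events differ only if one of the `k` buckets owes its fullness to an interval longer
than `M`. The truncated event depends on finitely many counts. -/
lemma HasGeometricTail.abs_sub_allFullWithin_le {b : ℕ} {ρ : ℝ} {ν : Measure (ℤ → ℕ)}
    [IsFiniteMeasure ν] (h : HasGeometricTail b ρ ν) (h0 : 0 ≤ ρ) (h1 : ρ < 1) (k M : ℕ) :
    |ν.real {x | ∀ j < k, IsFull b x (j : ℕ)} - ν.real {x | ∀ j < k, IsFullWithin b M x (j : ℕ)}|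
      ≤ k * (ρ ^ M * (1 - ρ)⁻¹) := by
  have hsub : {x : ℤ → ℕ | ∀ j < k, IsFullWithin b M x (j : ℕ)}
      ⊆ {x | ∀ j < k, IsFull b x (j : ℕ)} := by
    intro x hx j hj
    obtain ⟨L, h1, -, h2⟩ := hx j hj
    exact ⟨L, h1, h2⟩
  rw [← measureReal_sdiff hsub (measurableSet_allFullWithin b M k), abs_of_nonneg measureReal_nonneg]
  have hnn : 0 ≤ ρ ^ M * (1 - ρ)⁻¹ := by
    have : 0 < 1 - ρ := by linarith
    positivity
  calc _ ≤ ν.real (⋃ j ∈ Finset.range k,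
        {x : ℤ → ℕ | ∃ L, M ≤ L ∧ b * L ≤ ∑ l ∈ Finset.range L, x ((j : ℕ) - (l : ℤ))}) := by
        refine measureReal_mono ?_ (measure_ne_top _ _)
        rintro x ⟨hx1, hx2⟩
        simp only [Set.mem_ofPred_eq, not_forall] at hx2
        obtain ⟨j, hj, hx2⟩ := hx2
        obtain ⟨L, hL, hx⟩ := hx1 j hj
        simp only [Set.mem_iUnion, Finset.mem_range]
        refine ⟨j, hj, L, ?_, hx⟩
        by_contra! hc
        exact hx2 ⟨L, hL, hc.le, hx⟩
    _ ≤ ∑ j ∈ Finset.range k, ν.real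
        {x : ℤ → ℕ | ∃ L, M ≤ L ∧ b * L ≤ ∑ l ∈ Finset.range L, x ((j : ℕ) - (l : ℤ))} :=
      measureReal_biUnion_finset_le _ _
    _ ≤ ∑ _j ∈ Finset.range k, ρ ^ M * (1 - ρ)⁻¹ :=
      Finset.sum_le_sum fun j _ => ENNReal.toReal_le_of_le_ofReal hnn (h.exists_le h0 h1 j M)
    _ = k * (ρ ^ M * (1 - ρ)⁻¹) := by simp

lemma tendsto_of_uniform_approx {ι : Type*} {l : Filter ι} {a : ι → ℝ} {a' : ℝ}
    {c : ℕ → ι → ℝ} {c' e : ℕ → ℝ} (he : Tendsto e atTop (𝓝 0))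
    (h1 : ∀ M, ∀ᶠ i in l, |a i - c M i| ≤ e M) (h2 : ∀ M, |a' - c' M| ≤ e M)
    (h3 : ∀ M, Tendsto (c M) l (𝓝 (c' M))) : Tendsto a l (𝓝 a') := by
  rw [Metric.tendsto_nhds]
  intro ε hε
  obtain ⟨M, hM⟩ := ((tendsto_order.1 he).2 (ε / 3) (by positivity)).exists
  filter_upwards [h1 M, (Metric.tendsto_nhds.1 (h3 M)) (ε / 3) (by positivity)] with i hi1 hi2
  rw [Real.dist_eq] at hi2 ⊢
  have := h2 M
  rw [abs_le] at hi1 this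
  rw [abs_lt] at hi2 ⊢
  constructor <;> linarith

/-- Convergence of the finite-dimensional distributions and uniform geometric tails imply
convergence of the law of `infiniteU`. -/
lemma tendsto_map_infiniteU {b : ℕ} (hb : 1 ≤ b) {ρ : ℝ} (h0 : 0 ≤ ρ) (h1 : ρ < 1)
    {ι : Type*} {l : Filter ι} {νs : ι → Measure (ℤ → ℕ)} [∀ i, IsFiniteMeasure (νs i)]
    {ν : Measure (ℤ → ℕ)} [IsFiniteMeasure ν]
    (hνs : ∀ᶠ i in l, HasGeometricTail b ρ (νs i)) (hν : HasGeometricTail b ρ ν)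
    (hfd : ∀ (W : Finset ℤ) (A : Set (W → ℕ)),
      Tendsto (fun i => (νs i).real (W.restrict ⁻¹' A)) l (𝓝 (ν.real (W.restrict ⁻¹' A)))) (k : ℕ) :
    Tendsto (fun i => ((νs i).map (infiniteU b)).real {k}) l
      (𝓝 ((ν.map (infiniteU b)).real {k})) := by
  have key : ∀ k : ℕ, Tendsto (fun i => (νs i).real {x | ∀ j < k, IsFull b x (j : ℕ)}) l
      (𝓝 (ν.real {x | ∀ j < k, IsFull b x (j : ℕ)})) := by
    intro k
    refine tendsto_of_uniform_approx (e := fun M => k * (ρ ^ M * (1 - ρ)⁻¹))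
      (c := fun M i => (νs i).real {x | ∀ j < k, IsFullWithin b M x (j : ℕ)})
      (c' := fun M => ν.real {x | ∀ j < k, IsFullWithin b M x (j : ℕ)}) ?_ ?_ ?_ ?_
    · simpa using ((tendsto_pow_atTop_nhds_zero_of_lt_one h0 h1).mul_const
        ((1 - ρ)⁻¹)).const_mul (k : ℝ)
    · exact fun M => hνs.mono fun i hi => hi.abs_sub_allFullWithin_le h0 h1 k M
    · exact fun M => hν.abs_sub_allFullWithin_le h0 h1 k M
    · intro M
      -- The addresses that matter are `j - l` with `j < k` and `l < M`, all of which lie in this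
      -- window.
      have hset : {x : ℤ → ℕ | ∀ j < k, IsFullWithin b M x (j : ℕ)}
          = (Finset.Icc (-(M : ℤ)) k).restrict ⁻¹'
            {y | ∀ j < k, IsFullWithin b M (extendZero y) (j : ℕ)} := by
        ext x
        refine forall₂_congr fun j hj => (isFullWithin_extendZero x j fun l hl => ?_).symm
        rw [Finset.mem_Icc]; omega
      rw [hset]
      exact hfd _ _
  rw [hν.measure_infiniteU_eq hb h0 h1]
  refine ((key k).sub (key (k + 1))).congr' ?_
  filter_upwards [hνs] with i hi
  rw [hi.measure_infiniteU_eq hb h0 h1]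

/-! ### Laws on `ℕ` with geometric tails -/

section GeometricLaw

variable {C ρ R G : ℝ} {E : Type*} [NormedAddCommGroup E]

lemma integrable_iff_summable_of_countable {α : Type*} [Countable α] [MeasurableSpace α]
    [MeasurableSingletonClass α] {μ : Measure α} [IsFiniteMeasure μ] {g : α → E} :
    Integrable g μ ↔ Summable fun k => μ.real {k} * ‖g k‖ := by
  conv_lhs => rw [← Measure.sum_smul_dirac μ]
  exact integrable_sum_dirac_iff fun k => measure_ne_top _ _

lemma integrable_of_geometric_tail {μ : Measure ℕ} [IsFiniteMeasure μ]
    (hμ : ∀ k, μ.real {k} ≤ C * ρ ^ k) (hρ : 0 ≤ ρ) (hR : 0 ≤ R) (hρR : ρ * R < 1)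
    {g : ℕ → E} (hg : ∀ k, ‖g k‖ ≤ G * R ^ k) : Integrable g μ := by
  rw [integrable_iff_summable_of_countable]
  refine Summable.of_nonneg_of_le (fun k => by positivity) (fun k => ?_)
    ((summable_geometric_of_lt_one (mul_nonneg hρ hR) hρR).mul_left (C * G))
  calc μ.real {k} * ‖g k‖ ≤ (C * ρ ^ k) * (G * R ^ k) :=
        mul_le_mul (hμ k) (hg k) (norm_nonneg _) (measureReal_nonneg.trans (hμ k))
    _ = C * G * (ρ * R) ^ k := by rw [mul_pow]; ring

lemma abs_sub_mul_pow_le {a a' : ℝ} {k : ℕ} (ha : 0 ≤ a) (ha' : 0 ≤ a') (h : a ≤ C * ρ ^ k)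
    (h' : a' ≤ C * ρ ^ k) (hR : 0 ≤ R) : |a - a'| * R ^ k ≤ C * (ρ * R) ^ k := by
  have : |a - a'| ≤ C * ρ ^ k := by rw [abs_le]; constructor <;> linarith
  calc |a - a'| * R ^ k ≤ C * ρ ^ k * R ^ k := by gcongr
    _ = C * (ρ * R) ^ k := by rw [mul_pow]; ring

/-- One weighted `ℓ¹` distance controls every test function of growth `R ^ k` simultaneously:
bounded functions, powers, and `q ^ k` for all `q` with `‖q‖ ≤ R`, hence the uniformity in `q`. -/
lemma norm_integral_sub_le [NormedSpace ℝ E] [CompleteSpace E] {μ μ' : Measure ℕ} [IsFiniteMeasure μ]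
    [IsFiniteMeasure μ'] (hμ : ∀ k, μ.real {k} ≤ C * ρ ^ k) (hμ' : ∀ k, μ'.real {k} ≤ C * ρ ^ k)
    (hρ : 0 ≤ ρ) (hR : 0 ≤ R) (hρR : ρ * R < 1) {g : ℕ → E} (hg : ∀ k, ‖g k‖ ≤ G * R ^ k) :
    ‖∫ k, g k ∂μ - ∫ k, g k ∂μ'‖ ≤ G * ∑' k, |μ.real {k} - μ'.real {k}| * R ^ k := by
  have hi := integrable_of_geometric_tail hμ hρ hR hρR hg
  have hi' := integrable_of_geometric_tail hμ' hρ hR hρR hg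
  have hs := integrable_iff_summable_of_countable.1 hi
  have hs' := integrable_iff_summable_of_countable.1 hi'
  have hns : ∀ (μ : Measure ℕ), (Summable fun k => μ.real {k} * ‖g k‖) →
      Summable fun k => μ.real {k} • g k := fun μ h =>
    Summable.of_norm (h.congr fun k => by
      rw [norm_smul, Real.norm_of_nonneg measureReal_nonneg])
  rw [integral_countable hi, integral_countable hi', ← (hns μ hs).tsum_sub (hns μ' hs'),
    ← tsum_mul_left]
  refine tsum_of_norm_bounded (Summable.hasSum ?_) fun k => ?_
  · refine Summable.mul_left _ ?_
    exact Summable.of_nonneg_of_le (fun k => by positivity)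
      (fun k => abs_sub_mul_pow_le measureReal_nonneg measureReal_nonneg (hμ k) (hμ' k) hR)
      ((summable_geometric_of_lt_one (mul_nonneg hρ hR) hρR).mul_left C)
  · rw [← sub_smul, norm_smul, Real.norm_eq_abs, mul_left_comm]
    exact mul_le_mul_of_nonneg_left (hg k) (abs_nonneg _)

lemma tendsto_tsum_abs_sub {ι : Type*} {l : Filter ι} {μs : ι → Measure ℕ} {μ : Measure ℕ}
    (hμs : ∀ᶠ i in l, ∀ k, (μs i).real {k} ≤ C * ρ ^ k) (hμ : ∀ k, μ.real {k} ≤ C * ρ ^ k)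
    (hρ : 0 ≤ ρ) (hR : 0 ≤ R) (hρR : ρ * R < 1)
    (h : ∀ k, Tendsto (fun i => (μs i).real {k}) l (𝓝 (μ.real {k}))) :
    Tendsto (fun i => ∑' k, |(μs i).real {k} - μ.real {k}| * R ^ k) l (𝓝 0) := by
  have := tendsto_tsum_of_dominated_convergence (𝓕 := l)
    (f := fun i k => |(μs i).real {k} - μ.real {k}| * R ^ k) (g := fun _ => (0 : ℝ))
    ((summable_geometric_of_lt_one (mul_nonneg hρ hR) hρR).mul_left C) (fun k => ?_) ?_
  · simpa using this
  · simpa using (((h k).sub_const (μ.real {k})).abs).mul_const (R ^ k)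
  · filter_upwards [hμs] with i hi k
    rw [Real.norm_of_nonneg (by positivity)]
    exact abs_sub_mul_pow_le measureReal_nonneg measureReal_nonneg (hi k) (hμ k) hR

end GeometricLaw

/-! ### Exponential moments and geometric tails -/

/-- A uniform exponential moment bound yields geometric tails. -/
lemma hasGeometricTail_of_integral_exp_le {b : ℕ} {ν : Measure (ℤ → ℕ)} [IsFiniteMeasure ν]
    {t c : ℝ} (ht : 0 ≤ t)
    (hint : ∀ (i : ℤ) (L : ℕ), Integrable (fun x : ℤ → ℕ =>
      Real.exp (t * ((∑ j ∈ Finset.range L, x (i - (j : ℤ)) : ℕ) : ℝ))) ν)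
    (hle : ∀ (i : ℤ) (L : ℕ), ∫ x : ℤ → ℕ,
      Real.exp (t * ((∑ j ∈ Finset.range L, x (i - (j : ℤ)) : ℕ) : ℝ)) ∂ν ≤ Real.exp (c * L)) :
    HasGeometricTail b (Real.exp (c - t * b)) ν := by
  intro i L
  have h := measure_ge_le_exp_mul_mgf (μ := ν)
    (X := fun x : ℤ → ℕ => ((∑ j ∈ Finset.range L, x (i - (j : ℤ)) : ℕ) : ℝ))
    ((b * L : ℕ) : ℝ) ht (hint i L)
  rw [← ENNReal.ofReal_toReal (measure_ne_top ν _)]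
  refine ENNReal.ofReal_le_ofReal ?_
  simp only [Nat.cast_le] at h
  refine h.trans ((mul_le_mul_of_nonneg_left (hle i L) (Real.exp_pos _).le).trans_eq ?_)
  rw [← Real.exp_add, ← Real.exp_nat_mul]
  congr 1; push_cast; ring

lemma integrable_pow_poissonMeasure (r : NNReal) (z : ℂ) :
    Integrable (fun n : ℕ => z ^ n) (poissonMeasure r) := by
  rw [integrable_poissonMeasure_iff]
  have h := (NormedSpace.expSeries_div_hasSum_exp ((r : ℝ) * ‖z‖)).summable.mul_left
    (Real.exp (-r))
  refine h.congr fun n => ?_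
  rw [norm_pow, mul_pow]; ring

lemma integral_pow_poissonMeasure (r : NNReal) (z : ℂ) :
    ∫ n : ℕ, z ^ n ∂(poissonMeasure r) = Complex.exp (r * (z - 1)) := by
  rw [integral_poissonMeasure]
  have h := (NormedSpace.expSeries_div_hasSum_exp ((r : ℂ) * z)).mul_left (Complex.exp (-r))
  rw [← Complex.exp_eq_exp_ℂ, ← Complex.exp_add] at h
  rw [show (r : ℂ) * (z - 1) = -r + r * z by ring, ← h.tsum_eq]
  refine tsum_congr fun n => ?_
  rw [Complex.real_smul, mul_pow]; push_cast; ring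

lemma integral_exp_poissonMeasure (r : NNReal) (t : ℝ) :
    ∫ n : ℕ, Real.exp (t * n) ∂(poissonMeasure r) = Real.exp (r * (Real.exp t - 1)) := by
  have h := integral_pow_poissonMeasure r (Real.exp t : ℂ)
  have h2 : ∀ n : ℕ, (Real.exp t : ℂ) ^ n = ((Real.exp (t * n) : ℝ) : ℂ) := by
    intro n
    rw [mul_comm, Real.exp_nat_mul]; push_cast; rfl
  simp_rw [h2] at h
  rw [integral_complex_ofReal] at h
  exact_mod_cast h

lemma integrable_exp_poissonMeasure (r : NNReal) (t : ℝ) :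
    Integrable (fun n : ℕ => Real.exp (t * n)) (poissonMeasure r) := by
  refine (integrable_pow_poissonMeasure r (Real.exp t : ℂ)).norm.congr ?_
  refine Eventually.of_forall fun n => ?_
  simp [mul_comm t, Real.exp_nat_mul]

lemma measurePreserving_eval_poissonModel (b : ℕ) (α : ℝ) (i : ℤ) :
    MeasurePreserving (fun x : ℤ → ℕ => x i) (poissonModel b α)
      (poissonMeasure ((b : ℝ) * α).toNNReal) :=
  measurePreserving_eval_infinitePi (fun _ : ℤ => poissonMeasure ((b : ℝ) * α).toNNReal) i

lemma iIndepFun_poissonModel (b : ℕ) (α : ℝ) {β : Type*} [MeasurableSpace β] (f : ℕ → β) :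
    iIndepFun (fun (i : ℤ) (x : ℤ → ℕ) => f (x i)) (poissonModel b α) :=
  iIndepFun_infinitePi (P := fun _ : ℤ => poissonMeasure ((b : ℝ) * α).toNNReal)
    (X := fun _ n => f n) fun _ => Measurable.of_discrete

lemma hasGeometricTail_poissonModel (b : ℕ) {α t : ℝ} (hα : 0 ≤ α) (ht : 0 ≤ t) :
    HasGeometricTail b (Real.exp (b * α * (Real.exp t - 1) - t * b)) (poissonModel b α) := by
  have hind : ∀ i : ℤ, iIndepFun (fun (j : ℕ) (x : ℤ → ℕ) => (x (i - (j : ℤ)) : ℝ))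
      (poissonModel b α) := fun i =>
    (iIndepFun_poissonModel b α (fun n => (n : ℝ))).precomp (g := fun j : ℕ => i - (j : ℤ))
      fun j k h => by simpa using h
  have hmeas : ∀ (i : ℤ) (j : ℕ), Measurable fun x : ℤ → ℕ => (x (i - (j : ℤ)) : ℝ) :=
    fun i j => (Measurable.of_discrete (f := fun n : ℕ => (n : ℝ))).comp (measurable_pi_apply _)
  have hsum : ∀ (i : ℤ) (L : ℕ) (x : ℤ → ℕ), ((∑ j ∈ Finset.range L, x (i - (j : ℤ)) : ℕ) : ℝ)
      = (∑ j ∈ Finset.range L, fun x : ℤ → ℕ => (x (i - (j : ℤ)) : ℝ)) x := by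
    intro i L x; simp
  refine hasGeometricTail_of_integral_exp_le ht (fun i L => ?_) fun i L => ?_
  · simp_rw [hsum]
    refine (hind i).integrable_exp_mul_sum (hmeas i) fun j _ => ?_
    exact ((measurePreserving_eval_poissonModel b α (i - j)).integrable_comp
      (Measurable.of_discrete.aestronglyMeasurable)).2 (integrable_exp_poissonMeasure _ t)
  · simp_rw [hsum]
    refine ((hind i).mgf_sum (hmeas i) (t := t) (Finset.range L)).trans_le (le_of_eq ?_)
    have : ∀ j : ℕ, mgf (fun x : ℤ → ℕ => (x (i - (j : ℤ)) : ℝ)) (poissonModel b α) t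
        = Real.exp (b * α * (Real.exp t - 1)) := by
      intro j
      have h := integral_map (μ := poissonModel b α) (φ := fun x : ℤ → ℕ => x (i - (j : ℤ)))
        (f := fun n : ℕ => Real.exp (t * n)) (measurable_pi_apply _).aemeasurable
        Measurable.of_discrete.aestronglyMeasurable
      rw [(measurePreserving_eval_poissonModel b α (i - j)).map_eq,
        integral_exp_poissonMeasure, Real.coe_toNNReal _ (by positivity)] at h
      exact h.symm
    rw [Finset.prod_congr rfl fun j _ => this j, Finset.prod_const, Finset.card_range,
      ← Real.exp_nat_mul, mul_comm]

/-! ### The exact model -/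

/-- The number of `j < L` with `i - j ≡ g` modulo `m`. -/
def windowCount (m : ℕ) (i : ℤ) (L : ℕ) (g : ZMod m) : ℕ :=
  ∑ j ∈ Finset.range L, if g = ((i - (j : ℤ) : ℤ) : ZMod m) then 1 else 0

lemma sum_periodicCount {m n : ℕ} (h : Fin n → ZMod m) (i : ℤ) (L : ℕ) :
    ∑ j ∈ Finset.range L, periodicCount h (i - (j : ℤ)) = ∑ k, windowCount m i L (h k) := by
  unfold periodicCount windowCount
  rw [Finset.sum_comm]

section Exact

variable {m n : ℕ} [NeZero m]

lemma integral_uniformOn_univ {E : Type*} [NormedAddCommGroup E] [NormedSpace ℝ E]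
    [CompleteSpace E] (f : ZMod m → E) :
    ∫ g, f g ∂(uniformOn (Set.univ : Set (ZMod m))) = (m : ℝ)⁻¹ • ∑ g, f g := by
  rw [integral_fintype .of_finite, Finset.smul_sum]
  refine Finset.sum_congr rfl fun g _ => ?_
  congr 1
  rw [measureReal_def, uniformOn_univ]
  simp [ZMod.card]

lemma integral_exactModel_prod {𝕜 : Type*} [RCLike 𝕜] (f : ZMod m → 𝕜) :
    ∫ h, ∏ k, f (h k) ∂(exactModel m n) = ((m : ℝ)⁻¹ • ∑ g, f g) ^ n := by
  unfold exactModel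
  rw [integral_fintype_prod_eq_pow, integral_uniformOn_univ, Fintype.card_fin]

/-- The interval may be longer than the cycle: it winds `L / m` times around, and the remaining `L %
m` buckets are met once more. -/
lemma windowCount_eq (i : ℤ) (L : ℕ) (g : ZMod m) :
    windowCount m i L g = L / m + if ((i : ZMod m) - g).val < L % m then 1 else 0 := by
  have hm : 0 < m := NeZero.pos m
  have h := Nat.count_modEq_card L hm ((i : ZMod m) - g).val
  rw [Nat.mod_eq_of_lt (ZMod.val_lt _)] at h
  rw [← h, Nat.count_eq_card_filter_range, windowCount, Finset.sum_boole, Nat.cast_id]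
  congr 1
  refine Finset.filter_congr fun j _ => ?_
  rw [← ZMod.natCast_eq_natCast_iff, ZMod.natCast_val, ZMod.cast_id]
  push_cast
  constructor
  · intro h; rw [h]; ring
  · intro h; rw [h]; ring

/-- The next bucket to be added, `i - L`, lies just outside the incomplete last turn, so it has been
covered least often. -/
lemma windowCount_le (i : ℤ) (L : ℕ) (g : ZMod m) :
    windowCount m i L ((i - (L : ℤ) : ℤ) : ZMod m) ≤ windowCount m i L g := by
  rw [windowCount_eq, windowCount_eq, if_neg]
  · omega
  · have : (i : ZMod m) - ((i - (L : ℤ) : ℤ) : ZMod m) = (L : ZMod m) := by push_cast; ring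
    rw [this, ZMod.val_natCast]
    exact lt_irrefl _

/-- The interval is enlarged one bucket at a time. Each addition multiplies a single summand by `exp
t`, and that summand is the smallest one, hence at most the average. So the average grows by a
factor at most `1 + (exp t - 1) / m`, which gives a Poisson-type bound even for intervals that wrap
around the cycle. -/
lemma average_exp_windowCount_le (i : ℤ) (L : ℕ) {t : ℝ} (ht : 0 ≤ t) :
    (m : ℝ)⁻¹ * ∑ g : ZMod m, Real.exp (t * windowCount m i L g)
      ≤ Real.exp ((Real.exp t - 1) / m * L) := by
  have hm : (0 : ℝ) < m := by exact_mod_cast NeZero.pos m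
  have he : 0 ≤ Real.exp t - 1 := by linarith [Real.add_one_le_exp t]
  induction L with
  | zero => simp [windowCount, ZMod.card, hm.ne']
  | succ L ih =>
    set g₀ : ZMod m := ((i - (L : ℤ) : ℤ) : ZMod m) with hg₀
    have hstep : ∀ g, Real.exp (t * windowCount m i (L + 1) g)
        = Real.exp (t * windowCount m i L g)
          + if g = g₀ then (Real.exp t - 1) * Real.exp (t * windowCount m i L g₀) else 0 := by
      intro g
      have : windowCount m i (L + 1) g = windowCount m i L g + if g = g₀ then 1 else 0 := by
        rw [windowCount, Finset.sum_range_succ]; rfl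
      rw [this]
      split_ifs with h
      · rw [h, Nat.cast_add, mul_add, Real.exp_add]; simp; ring
      · simp
    have hmin : Real.exp (t * windowCount m i L g₀)
        ≤ (m : ℝ)⁻¹ * ∑ g : ZMod m, Real.exp (t * windowCount m i L g) := by
      rw [le_inv_mul_iff₀ hm]
      have := Finset.card_nsmul_le_sum (Finset.univ : Finset (ZMod m))
        (fun g => Real.exp (t * windowCount m i L g)) (Real.exp (t * windowCount m i L g₀))
        fun g _ => Real.exp_le_exp.2
          (mul_le_mul_of_nonneg_left (by exact_mod_cast windowCount_le i L g) ht)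
      simpa [ZMod.card] using this
    simp_rw [hstep]
    rw [Finset.sum_add_distrib, Finset.sum_ite_eq' Finset.univ g₀, if_pos (Finset.mem_univ _)]
    set S := (m : ℝ)⁻¹ * ∑ g : ZMod m, Real.exp (t * windowCount m i L g) with hS
    calc (m : ℝ)⁻¹ * (∑ g : ZMod m, Real.exp (t * windowCount m i L g)
            + (Real.exp t - 1) * Real.exp (t * windowCount m i L g₀))
        = S + (Real.exp t - 1) / m * Real.exp (t * windowCount m i L g₀) := by
          rw [hS]; field_simp
      _ ≤ S + (Real.exp t - 1) / m * S := by gcongr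
      _ = (1 + (Real.exp t - 1) / m) * S := by ring
      _ ≤ Real.exp ((Real.exp t - 1) / m) * Real.exp ((Real.exp t - 1) / m * L) := by
          refine mul_le_mul ?_ ih (by positivity) (Real.exp_pos _).le
          rw [add_comm]; exact Real.add_one_le_exp _
      _ = Real.exp ((Real.exp t - 1) / m * (L + 1 : ℕ)) := by
          rw [← Real.exp_add]; congr 1; push_cast; ring

lemma measurable_periodicCount : Measurable (periodicCount : (Fin n → ZMod m) → ℤ → ℕ) :=
  Measurable.of_discrete

/-- The law of the numbers of keys in the exact model, read periodically. -/
noncomputable def periodicModel (m n : ℕ) [NeZero m] : Measure (ℤ → ℕ) :=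
  (exactModel m n).map periodicCount

instance : IsProbabilityMeasure (periodicModel m n) :=
  Measure.isProbabilityMeasure_map measurable_periodicCount.aemeasurable

lemma hasGeometricTail_periodicModel {b : ℕ} {β t : ℝ} (ht : 0 ≤ t) (hn : (n : ℝ) ≤ b * β * m) :
    HasGeometricTail b (Real.exp (b * β * (Real.exp t - 1) - t * b)) (periodicModel m n) := by
  have hm : (0 : ℝ) < m := by exact_mod_cast NeZero.pos m
  have he : 0 ≤ Real.exp t - 1 := by linarith [Real.add_one_le_exp t]
  have hmeas : ∀ (i : ℤ) (L : ℕ), Measurable fun x : ℤ → ℕ =>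
      Real.exp (t * ((∑ j ∈ Finset.range L, x (i - (j : ℤ)) : ℕ) : ℝ)) := fun i L =>
    (Measurable.of_discrete (f := fun k : ℕ => Real.exp (t * k))).comp
      (Finset.measurable_sum _ fun _ _ => measurable_pi_apply _)
  refine hasGeometricTail_of_integral_exp_le ht (fun i L => ?_) fun i L => ?_
  · exact (integrable_map_measure (hmeas i L).aestronglyMeasurable
      measurable_periodicCount.aemeasurable).2 .of_finite
  · rw [periodicModel, integral_map measurable_periodicCount.aemeasurable
      (hmeas i L).aestronglyMeasurable]
    -- The number of keys in the interval is a sum over the keys of independent window counts, so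
    -- the exponential moment is an `n`-th power.
    simp_rw [sum_periodicCount, Nat.cast_sum, Finset.mul_sum, Real.exp_sum]
    have hp := integral_exactModel_prod (m := m) (n := n)
      (fun g => Real.exp (t * windowCount m i L g))
    rw [hp, smul_eq_mul]
    refine (pow_le_pow_left₀ (by positivity) (average_exp_windowCount_le i L ht) n).trans ?_
    rw [← Real.exp_nat_mul]
    refine Real.exp_le_exp.2 ?_
    calc (n : ℝ) * ((Real.exp t - 1) / m * L) ≤ (b * β * m) * ((Real.exp t - 1) / m * L) := by
          gcongr
      _ = b * β * (Real.exp t - 1) * L := by field_simp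

end Exact

/-! ### Convergence of the finite-dimensional distributions -/

/-- The embedding of the integer vectors into Euclidean space. -/
noncomputable def latticeEmbedding {W : Type*} (y : W → ℕ) : EuclideanSpace ℝ W :=
  WithLp.toLp 2 fun i => (y i : ℝ)

lemma measurable_latticeEmbedding {W : Type*} : Measurable (latticeEmbedding (W := W)) := by
  unfold latticeEmbedding
  refine (MeasurableEquiv.toLp 2 (W → ℝ)).measurable.comp ?_
  exact measurable_pi_iff.2 fun i =>
    (Measurable.of_discrete (f := fun n : ℕ => (n : ℝ))).comp (measurable_pi_apply i)

section Lattice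

variable {W : Type*} [Fintype W]

lemma one_le_dist_latticeEmbedding {y z : W → ℕ} (h : y ≠ z) :
    1 ≤ dist (latticeEmbedding y) (latticeEmbedding z) := by
  obtain ⟨i, hi⟩ := Function.ne_iff.1 h
  have h1 : (1 : ℝ) ≤ |(y i : ℝ) - z i| := by
    have : (1 : ℤ) ≤ |(y i : ℤ) - z i| := Int.one_le_abs (by omega)
    exact_mod_cast this
  have h2 := PiLp.norm_apply_le (latticeEmbedding y - latticeEmbedding z) i
  rw [dist_eq_norm]
  exact h1.trans (by simpa [latticeEmbedding] using h2)

/-- Distinct lattice points are at distance at least `1`, so a tent function of height and radius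
`1` around `A` takes only the values `0` and `1` on the lattice. Weak convergence thus yields
convergence of every probability. -/
lemma exists_boundedContinuous_eq_indicator (A : Set (W → ℕ)) :
    ∃ g : BoundedContinuousFunction (EuclideanSpace ℝ W) ℝ,
      ∀ y, g (latticeEmbedding y) = A.indicator 1 y := by
  rcases A.eq_empty_or_nonempty with rfl | hA
  · exact ⟨0, by simp⟩
  refine ⟨BoundedContinuousFunction.ofNormedAddCommGroup
    (fun v => max 0 (1 - Metric.infDist v (latticeEmbedding '' A)))
    (by fun_prop) 1 fun v => ?_, fun y => ?_⟩
  · rw [Real.norm_of_nonneg (le_max_left _ _)]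
    exact max_le zero_le_one (by linarith [Metric.infDist_nonneg (x := v) (s := latticeEmbedding '' A)])
  · change max 0 (1 - Metric.infDist (latticeEmbedding y) (latticeEmbedding '' A)) = _
    by_cases hy : y ∈ A
    · rw [Metric.infDist_zero_of_mem (Set.mem_image_of_mem _ hy)]
      simp [hy]
    · have : 1 ≤ Metric.infDist (latticeEmbedding y) (latticeEmbedding '' A) := by
        rw [Metric.le_infDist (hA.image _)]
        rintro _ ⟨z, hz, rfl⟩
        exact one_le_dist_latticeEmbedding fun h => hy (h ▸ hz)
      rw [max_eq_left (by linarith)]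
      simp [hy]

lemma charFun_map_latticeEmbedding (μ : Measure (W → ℕ)) (t : EuclideanSpace ℝ W) :
    charFun (μ.map latticeEmbedding) t
      = ∫ y, ∏ i, Complex.exp (t i * Complex.I) ^ y i ∂μ := by
  rw [charFun_apply, integral_map measurable_latticeEmbedding.aemeasurable (by fun_prop)]
  refine integral_congr_ae (Eventually.of_forall fun y => ?_)
  simp only [PiLp.inner_apply, latticeEmbedding, ← Complex.exp_nat_mul, ← Complex.exp_sum]
  congr 1
  push_cast
  rw [Finset.sum_mul]
  refine Finset.sum_congr rfl fun i _ => ?_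
  simp; ring

/-- Convergence of the generating functions on the unit torus implies convergence of all
probabilities, for integer vectors. -/
lemma tendsto_measureReal_of_tendsto_generatingFunction {μs : ℕ → Measure (W → ℕ)}
    {μ : Measure (W → ℕ)} [∀ k, IsProbabilityMeasure (μs k)] [IsProbabilityMeasure μ]
    (h : ∀ t : W → ℝ, Tendsto (fun k => ∫ y, ∏ i, Complex.exp (t i * Complex.I) ^ y i ∂(μs k)) atTop
      (𝓝 (∫ y, ∏ i, Complex.exp (t i * Complex.I) ^ y i ∂μ))) (A : Set (W → ℕ)) :
    Tendsto (fun k => (μs k).real A) atTop (𝓝 (μ.real A)) := by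
  have hp : ∀ (μ : Measure (W → ℕ)) [IsProbabilityMeasure μ],
      IsProbabilityMeasure (μ.map latticeEmbedding) := fun μ _ =>
    Measure.isProbabilityMeasure_map measurable_latticeEmbedding.aemeasurable
  have hconv : Tendsto (β := ProbabilityMeasure (EuclideanSpace ℝ W))
      (fun k => ⟨(μs k).map latticeEmbedding, hp _⟩) atTop
      (𝓝 ⟨μ.map latticeEmbedding, hp _⟩) := by
    refine ProbabilityMeasure.tendsto_of_tendsto_charFun fun t => ?_
    simp only [ProbabilityMeasure.coe_mk, charFun_map_latticeEmbedding]
    exact h t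
  obtain ⟨g, hg⟩ := exists_boundedContinuous_eq_indicator A
  have hint : ∀ μ : Measure (W → ℕ), ∫ v, g v ∂(μ.map latticeEmbedding) = μ.real A := by
    intro μ
    rw [integral_map measurable_latticeEmbedding.aemeasurable
      g.continuous.aestronglyMeasurable]
    simp_rw [hg]
    exact integral_indicator_one A.to_countable.measurableSet
  have := ProbabilityMeasure.tendsto_iff_forall_integral_tendsto.1 hconv g
  simpa only [ProbabilityMeasure.coe_mk, hint] using this

end Lattice

lemma eventually_injOn_intCast {m : ℕ → ℕ} (hm : Tendsto m atTop atTop) (W : Finset ℤ) :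
    ∀ᶠ k in atTop, ∀ i ∈ W, ∀ j ∈ W, (i : ZMod (m k)) = j → i = j := by
  rw [Finset.eventually_all]
  intro i _
  rw [Finset.eventually_all]
  intro j _
  filter_upwards [hm.eventually_gt_atTop (j - i).natAbs] with k hk h
  rw [ZMod.intCast_eq_intCast_iff_dvd_sub] at h
  have := Int.eq_zero_of_abs_lt_dvd h (by rw [Int.abs_eq_natAbs]; exact_mod_cast hk)
  omega

/-- Once `W` embeds into the cycle, a key hits at most one bucket of `W`, so a single key
contributes the factor `1 + ∑ (z i - 1) / m`. -/
lemma integral_periodicModel_generatingFunction {m n : ℕ} [NeZero m] {W : Finset ℤ}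
    (hW : ∀ i ∈ W, ∀ j ∈ W, (i : ZMod m) = j → i = j) (z : W → ℂ) :
    ∫ y, ∏ i, z i ^ y i ∂((periodicModel m n).map W.restrict)
      = (1 + (∑ i, (z i - 1)) / m) ^ n := by
  have hm : (m : ℂ) ≠ 0 := by exact_mod_cast NeZero.ne m
  have hmeas : Measurable (fun y : W → ℕ => ∏ i, z i ^ y i) :=
    Finset.measurable_prod _ fun i _ =>
      (Measurable.of_discrete (f := fun n : ℕ => z i ^ n)).comp (measurable_pi_apply i)
  rw [integral_map (Finset.measurable_restrict W).aemeasurable hmeas.aestronglyMeasurable,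
    periodicModel, integral_map (f := fun x => ∏ i, z i ^ W.restrict x i)
      measurable_periodicCount.aemeasurable
      (hmeas.comp (Finset.measurable_restrict W)).aestronglyMeasurable]
  have h1 : ∀ h : Fin n → ZMod m, ∏ i : W, z i ^ (W.restrict (periodicCount h) i)
      = ∏ k, ∏ i : W, z i ^ (if h k = ((i : ℤ) : ZMod m) then 1 else 0) := by
    intro h
    rw [Finset.prod_comm]
    refine Finset.prod_congr rfl fun i _ => ?_
    rw [Finset.prod_pow_eq_pow_sum]; rfl
  simp_rw [h1]
  rw [integral_exactModel_prod (fun g => ∏ i : W, z i ^ (if g = ((i : ℤ) : ZMod m) then 1 else 0))]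
  congr 1
  have h2 : ∀ g : ZMod m, ∏ i : W, z i ^ (if g = ((i : ℤ) : ZMod m) then 1 else 0)
      = 1 + ∑ i : W, if g = ((i : ℤ) : ZMod m) then z i - 1 else 0 := by
    intro g
    by_cases hg : ∃ i : W, g = ((i : ℤ) : ZMod m)
    · obtain ⟨i₀, rfl⟩ := hg
      have hi : ∀ i : W, ((i₀ : ℤ) : ZMod m) = ((i : ℤ) : ZMod m) ↔ i = i₀ := fun i =>
        ⟨fun h => Subtype.ext (hW _ i₀.2 _ i.2 h).symm, fun h => by rw [h]⟩
      simp_rw [hi]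
      rw [Finset.sum_ite_eq' Finset.univ i₀, if_pos (Finset.mem_univ _),
        Finset.prod_eq_single i₀ (fun i _ h => by simp [h]) (by simp)]
      simp
    · push Not at hg
      simp [hg]
  simp_rw [h2]
  rw [Finset.sum_add_distrib, Finset.sum_comm]
  simp [ZMod.card, Complex.real_smul]
  field_simp

lemma integral_poissonModel_generatingFunction (b : ℕ) {α : ℝ} (hα : 0 ≤ α) (W : Finset ℤ)
    (z : W → ℂ) :
    ∫ y, ∏ i, z i ^ y i ∂((poissonModel b α).map W.restrict)
      = Complex.exp (b * α * ∑ i, (z i - 1)) := by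
  rw [poissonModel, Measure.infinitePi_map_restrict,
    integral_fintype_prod_eq_prod (fun (i : W) (n : ℕ) => z i ^ n)]
  simp_rw [integral_pow_poissonMeasure]
  rw [← Complex.exp_sum, ← Finset.mul_sum]
  congr 2
  have : 0 ≤ (b : ℝ) * α := by positivity
  rw [← Complex.ofReal_natCast, ← Complex.ofReal_mul]
  exact_mod_cast Real.coe_toNNReal _ this

lemma tendsto_one_add_div_pow {m n : ℕ → ℕ} (hm : Tendsto m atTop atTop) {β : ℝ}
    (hβ : Tendsto (fun k => (n k : ℝ) / m k) atTop (𝓝 β)) (c : ℂ) :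
    Tendsto (fun k => (1 + c / m k) ^ n k) atTop (𝓝 (Complex.exp (β * c))) := by
  have h1 : Tendsto (fun k : ℕ => (k : ℂ) * Complex.log (1 + c / k)) atTop (𝓝 c) := by
    refine Complex.tendsto_nat_mul_log_one_add_of_tendsto (tendsto_nhds_of_eventually_eq ?_)
    filter_upwards [eventually_ne_atTop 0] with k hk
    exact mul_div_cancel₀ c (by exact_mod_cast hk)
  have h2 : Tendsto (fun k => (((n k : ℝ) / m k : ℝ) : ℂ)) atTop (𝓝 (β : ℂ)) :=
    (Complex.continuous_ofReal.tendsto β).comp hβ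
  have h3 := (Complex.continuous_exp.tendsto _).comp (h2.mul (h1.comp hm))
  have h4 : Tendsto (fun k => 1 + c / (m k : ℂ)) atTop (𝓝 (1 + 0)) :=
    ((tendsto_const_div_atTop_nhds_zero_nat c).comp hm).const_add 1
  refine h3.congr' ?_
  filter_upwards [hm.eventually_ne_atTop 0, h4.eventually_ne (by simp : (1 + 0 : ℂ) ≠ 0)]
    with k hk hne
  have hk' : (m k : ℂ) ≠ 0 := by exact_mod_cast hk
  simp only [Function.comp]
  rw [show (((n k : ℝ) / m k : ℝ) : ℂ) * ((m k : ℂ) * Complex.log (1 + c / (m k : ℂ)))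
    = n k * Complex.log (1 + c / (m k : ℂ)) by push_cast; field_simp,
    Complex.exp_nat_mul, Complex.exp_log hne]

lemma tendsto_periodicModel_preimage_restrict {b : ℕ} (hb : 1 ≤ b) {α : ℝ} (hα : 0 ≤ α)
    {m n : ℕ → ℕ} [∀ k, NeZero (m k)] (hm : Tendsto m atTop atTop)
    (hmn : Tendsto (fun k => (n k : ℝ) / ((b : ℝ) * (m k : ℝ))) atTop (𝓝 α))
    (W : Finset ℤ) (A : Set (W → ℕ)) :
    Tendsto (fun k => (periodicModel (m k) (n k)).real (W.restrict ⁻¹' A)) atTop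
      (𝓝 ((poissonModel b α).real (W.restrict ⁻¹' A))) := by
  have hb' : (b : ℝ) ≠ 0 := by positivity
  have hA : MeasurableSet A := A.to_countable.measurableSet
  have hp : ∀ (μ : Measure (ℤ → ℕ)) [IsProbabilityMeasure μ],
      IsProbabilityMeasure (μ.map W.restrict) := fun μ _ =>
    Measure.isProbabilityMeasure_map (Finset.measurable_restrict W).aemeasurable
  have hβ : Tendsto (fun k => (n k : ℝ) / m k) atTop (𝓝 (b * α)) := by
    refine (hmn.const_mul (b : ℝ)).congr fun k => ?_
    field_simp
  have hreal : ∀ μ : Measure (ℤ → ℕ), μ.real (W.restrict ⁻¹' A) = (μ.map W.restrict).real A :=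
    fun μ => (map_measureReal_apply (Finset.measurable_restrict W) hA).symm
  simp_rw [hreal]
  refine tendsto_measureReal_of_tendsto_generatingFunction (fun t => ?_) A
  rw [integral_poissonModel_generatingFunction b hα]
  have := tendsto_one_add_div_pow hm hβ (∑ i, (Complex.exp (t i * Complex.I) - 1))
  rw [Complex.ofReal_mul, Complex.ofReal_natCast] at this
  refine this.congr' ?_
  filter_upwards [eventually_injOn_intCast hm W] with k hk
  rw [integral_periodicModel_generatingFunction hk]

/-! ### The tree function -/

lemma norm_treeT_term_le (n : ℕ) (z : ℂ) :
    ‖(((n : ℂ) + 1) ^ n / ((n + 1).factorial : ℂ)) * z ^ (n + 1)‖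
      ≤ (Real.exp 1 * ‖z‖) ^ (n + 1) := by
  have h1 : (((n + 1 : ℕ) : ℝ)) ^ (n + 1) / ((n + 1).factorial : ℝ) ≤ Real.exp ((n + 1 : ℕ) : ℝ) :=
    Real.pow_div_factorial_le_exp _ (by positivity) _
  have h2 : ((n + 1 : ℕ) : ℝ) ^ n ≤ ((n + 1 : ℕ) : ℝ) ^ (n + 1) :=
    pow_le_pow_right₀ (by push_cast; linarith [(Nat.cast_nonneg n : (0 : ℝ) ≤ n)]) (Nat.le_succ n)
  have h3 : ‖((n : ℂ) + 1) ^ n / ((n + 1).factorial : ℂ)‖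
      = ((n + 1 : ℕ) : ℝ) ^ n / ((n + 1).factorial : ℝ) := by
    rw [norm_div, norm_pow, Complex.norm_natCast, ← Nat.cast_succ, Complex.norm_natCast]
  rw [norm_mul, h3, norm_pow, mul_pow, ← Real.exp_nat_mul, mul_one]
  gcongr
  exact (div_le_div_of_nonneg_right h2 (by positivity)).trans h1

lemma differentiableOn_treeT :
    DifferentiableOn ℂ treeT (Metric.ball 0 (Real.exp (-1))) := by
  intro z hz
  rw [mem_ball_zero_iff] at hz
  obtain ⟨u, hzu, hu⟩ := exists_between hz
  have hu0 : 0 ≤ u := (norm_nonneg z).trans hzu.le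
  have hu1 : Real.exp 1 * u < 1 := by
    calc Real.exp 1 * u < Real.exp 1 * Real.exp (-1) := by gcongr
      _ = 1 := by rw [← Real.exp_add]; simp
  have h : DifferentiableOn ℂ treeT (Metric.ball 0 u) := by
    refine Complex.differentiableOn_tsum_of_summable_norm (u := fun n => (Real.exp 1 * u) ^ (n + 1))
      ?_ (fun n => by fun_prop) Metric.isOpen_ball fun n w hw => ?_
    · exact (summable_nat_add_iff 1).2 (summable_geometric_of_lt_one (by positivity) hu1)
    · rw [mem_ball_zero_iff] at hw
      exact (norm_treeT_term_le n w).trans (by gcongr)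
  exact (h.differentiableAt (Metric.isOpen_ball.mem_nhds (by simpa using hzu))).differentiableWithinAt

lemma analyticAt_treeT {z : ℂ} (hz : ‖z‖ < Real.exp (-1)) : AnalyticAt ℂ treeT z :=
  differentiableOn_treeT.analyticAt (Metric.isOpen_ball.mem_nhds (by simpa using hz))

lemma treeT_zero : treeT 0 = 0 := by simp [treeT]

/-- After multiplication by `(s + 1)!` the sum is, for `s ≥ 1`, the finite difference of order `s +
1` of `x ^ s` at `0`, which vanishes; the missing term of the difference is `0 ^ s = 0`. -/
lemma sum_antidiagonal_tree (s : ℕ) :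
    ∑ p ∈ Finset.HasAntidiagonal.antidiagonal s, (((p.1 : ℂ) + 1) ^ p.1 / ((p.1 + 1).factorial : ℂ))
      * ((-((p.1 : ℂ) + 1)) ^ p.2 / (p.2.factorial : ℂ)) = if s = 0 then 1 else 0 := by
  rcases Nat.eq_zero_or_pos s with rfl | hs
  · simp
  rw [if_neg hs.ne']
  have h := congrFun (fwdDiff_iter_pow_eq_zero_of_lt (R := ℂ) (Nat.lt_succ_self s)) 0
  rw [fwdDiff_iter_eq_sum_shift, Finset.sum_range_succ'] at h
  simp [hs.ne'] at h
  have hfac : (((s + 1).factorial : ℕ) : ℂ) ≠ 0 := by exact_mod_cast Nat.factorial_ne_zero _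
  rw [Finset.Nat.sum_antidiagonal_eq_sum_range_succ (fun i j => (((i : ℂ) + 1) ^ i /
    ((i + 1).factorial : ℂ)) * ((-((i : ℂ) + 1)) ^ j / (j.factorial : ℂ)))]
  refine mul_left_cancel₀ hfac ?_
  rw [mul_zero, Finset.mul_sum, ← h]
  refine Finset.sum_congr rfl fun k hk => ?_
  have hk' : k ≤ s := by simpa [Nat.lt_succ_iff] using hk
  have hc := Nat.choose_mul_factorial_mul_factorial (show k + 1 ≤ s + 1 by omega)
  rw [show s + 1 - (k + 1) = s - k by omega] at hc
  have h1 : (((k + 1).factorial : ℕ) : ℂ) ≠ 0 := by exact_mod_cast Nat.factorial_ne_zero _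
  have h2 : (((s - k).factorial : ℕ) : ℂ) ≠ 0 := by exact_mod_cast Nat.factorial_ne_zero _
  rw [← hc, neg_pow ((k : ℂ) + 1)]
  have h3 : ((k : ℂ) + 1) ^ s = ((k : ℂ) + 1) ^ k * ((k : ℂ) + 1) ^ (s - k) := by
    rw [← pow_add]; congr 1; omega
  push_cast
  rw [h3]
  field_simp

/-- Expanding the powers of `exp (-z)` gives an absolutely convergent double series. Regrouped by
total degree, its coefficients are those of `sum_antidiagonal_tree`, so only the linear term
remains. -/
lemma treeT_mul_exp_neg_of_small {z : ℂ} (hz : Real.exp 1 * (‖z‖ * Real.exp ‖z‖) < 1) :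
    treeT (z * Complex.exp (-z)) = z := by
  set F : ℕ × ℕ → ℂ := fun p => (((p.1 : ℂ) + 1) ^ p.1 / ((p.1 + 1).factorial : ℂ)) * z ^ (p.1 + 1)
    * ((-((p.1 : ℂ) + 1) * z) ^ p.2 / (p.2.factorial : ℂ)) with hF
  have hrow : ∀ n : ℕ, HasSum (fun j => F (n, j))
      ((((n : ℂ) + 1) ^ n / ((n + 1).factorial : ℂ)) * (z * Complex.exp (-z)) ^ (n + 1)) := by
    intro n
    have h := (NormedSpace.expSeries_div_hasSum_exp (-((n : ℂ) + 1) * z)).mul_left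
      ((((n : ℂ) + 1) ^ n / ((n + 1).factorial : ℂ)) * z ^ (n + 1))
    rw [← Complex.exp_eq_exp_ℂ] at h
    convert! h using 1
    rw [mul_pow, ← Complex.exp_nat_mul]
    push_cast
    rw [show ((n : ℂ) + 1) * -z = -((n : ℂ) + 1) * z by ring]
    ring
  have hnorm : ∀ n : ℕ, HasSum (fun j => ‖F (n, j)‖)
      (‖(((n : ℂ) + 1) ^ n / ((n + 1).factorial : ℂ)) * z ^ (n + 1)‖
        * Real.exp (((n : ℝ) + 1) * ‖z‖)) := by
    intro n
    have h := (NormedSpace.expSeries_div_hasSum_exp (((n : ℝ) + 1) * ‖z‖)).mul_left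
      ‖(((n : ℂ) + 1) ^ n / ((n + 1).factorial : ℂ)) * z ^ (n + 1)‖
    rw [← Real.exp_eq_exp_ℝ] at h
    convert! h using 1
    funext j
    rw [hF, norm_mul, norm_div, norm_pow _ j, norm_mul (-_) z, norm_neg, Complex.norm_natCast,
      ← Nat.cast_succ, Complex.norm_natCast]
    push_cast; rfl
  have hsum : Summable F := by
    refine Summable.of_norm ((summable_prod_of_nonneg fun p => norm_nonneg _).2
      ⟨fun n => (hnorm n).summable, ?_⟩)
    refine Summable.of_nonneg_of_le (fun n => tsum_nonneg fun j => norm_nonneg _) (fun n => ?_)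
      ((summable_nat_add_iff 1).2 (summable_geometric_of_lt_one (by positivity) hz))
    rw [(hnorm n).tsum_eq]
    calc _ ≤ (Real.exp 1 * ‖z‖) ^ (n + 1) * Real.exp (((n : ℝ) + 1) * ‖z‖) := by
          gcongr; exact norm_treeT_term_le n z
      _ = _ := by
          rw [show ((n : ℝ) + 1) * ‖z‖ = ((n + 1 : ℕ) : ℝ) * ‖z‖ by push_cast; ring,
            Real.exp_nat_mul, ← mul_pow, mul_assoc]
  have h1 : treeT (z * Complex.exp (-z)) = ∑' p, F p := by
    rw [hsum.tsum_prod]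
    exact tsum_congr fun n => (hrow n).tsum_eq.symm
  have hsum' : Summable fun c : (n : ℕ) × Finset.HasAntidiagonal.antidiagonal n =>
      F (Finset.HasAntidiagonal.sigmaAntidiagonalEquivProd c) :=
    (Finset.HasAntidiagonal.sigmaAntidiagonalEquivProd.summable_iff.2 hsum)
  rw [h1, ← Finset.HasAntidiagonal.sigmaAntidiagonalEquivProd.tsum_eq F, hsum'.tsum_sigma]
  have h2 : ∀ s : ℕ, ∑' p : Finset.HasAntidiagonal.antidiagonal s, F (Finset.HasAntidiagonal.sigmaAntidiagonalEquivProd ⟨s, p⟩)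
      = if s = 0 then z else 0 := by
    intro s
    rw [tsum_fintype]
    have h3 : ∑ p : Finset.HasAntidiagonal.antidiagonal s, F (Finset.HasAntidiagonal.sigmaAntidiagonalEquivProd ⟨s, p⟩)
        = ∑ p ∈ Finset.HasAntidiagonal.antidiagonal s, F p := Finset.sum_coe_sort (Finset.HasAntidiagonal.antidiagonal s) F
    rw [h3]
    have h4 : ∀ p ∈ Finset.HasAntidiagonal.antidiagonal s, F p = z ^ (s + 1) *
        ((((p.1 : ℂ) + 1) ^ p.1 / ((p.1 + 1).factorial : ℂ))
          * ((-((p.1 : ℂ) + 1)) ^ p.2 / (p.2.factorial : ℂ))) := by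
      intro p hp
      rw [Finset.HasAntidiagonal.mem_antidiagonal] at hp
      simp only [hF, ← hp, mul_pow]
      ring
    rw [Finset.sum_congr rfl h4, ← Finset.mul_sum, sum_antidiagonal_tree]
    split_ifs with h0
    · simp [h0]
    · simp
  rw [tsum_congr h2, tsum_ite_eq]

lemma eventually_treeT_mul_exp_neg : ∀ᶠ z : ℂ in 𝓝 0, treeT (z * Complex.exp (-z)) = z := by
  have h : Tendsto (fun z : ℂ => Real.exp 1 * (‖z‖ * Real.exp ‖z‖)) (𝓝 0) (𝓝 0) := by
    have : Continuous fun z : ℂ => Real.exp 1 * (‖z‖ * Real.exp ‖z‖) := by fun_prop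
    simpa using this.tendsto 0
  filter_upwards [(tendsto_order.1 h).2 1 one_pos] with z hz
  exact treeT_mul_exp_neg_of_small hz

/-- The map `z ↦ z exp (-z)` has derivative `1` at `0`, so it carries neighbourhoods of `0` onto
neighbourhoods of `0`; the left inverse is therefore also a right inverse nearby. -/
lemma eventually_treeT_mul_exp_neg_treeT :
    ∀ᶠ w : ℂ in 𝓝 0, treeT w * Complex.exp (-treeT w) = w := by
  have hd : HasStrictDerivAt (fun z : ℂ => z * Complex.exp (-z)) 1 0 := by
    have := (hasStrictDerivAt_id (0 : ℂ)).mul ((hasStrictDerivAt_id (0 : ℂ)).neg.cexp)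
    convert! this using 1
    simp
  have hmap := hd.map_nhds_eq one_ne_zero
  simp only [zero_mul] at hmap
  rw [← hmap, eventually_map]
  filter_upwards [eventually_treeT_mul_exp_neg] with z hz
  rw [hz]

lemma mul_exp_neg_lt {x : ℝ} (hx : x ≠ 1) : x * Real.exp (-x) < Real.exp (-1) := by
  have h := Real.add_one_lt_exp (sub_ne_zero.2 hx)
  calc x * Real.exp (-x) < Real.exp (x - 1) * Real.exp (-x) := by gcongr; linarith
    _ = Real.exp (-1) := by rw [← Real.exp_add]; congr 1; ring

lemma norm_mul_exp_neg (x : ℝ) : ‖(x : ℂ) * Complex.exp (-x)‖ = |x| * Real.exp (-x) := by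
  rw [norm_mul, Complex.norm_real, ← Complex.ofReal_neg, Complex.norm_exp_ofReal,
    Real.norm_eq_abs]

/-- The identity near `0` propagates along the real interval by analyticity, because `x exp (-x)`
stays strictly inside the disc of convergence until `x = 1`. -/
lemma treeT_mul_exp_neg_ofReal {x : ℝ} (hx0 : 0 ≤ x) (hx1 : x < 1) :
    treeT (x * Complex.exp (-x)) = x := by
  -- The interval starts slightly to the left of `0` so that `0` is an interior point. The value `1
  -- / 8` suffices because `exp (-y + 1) < exp 2 < 8` there.
  have hlt : ∀ y ∈ Set.Ioo (-(1 / 8) : ℝ) 1,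
      ‖(y : ℂ) * Complex.exp (-y)‖ < Real.exp (-1) := by
    intro y hy
    rw [norm_mul_exp_neg]
    rcases le_or_gt 0 y with h | h
    · rw [abs_of_nonneg h]; exact mul_exp_neg_lt hy.2.ne
    · rw [abs_of_neg h]
      have h1 : Real.exp (-y + 1) < 8 := by
        have h2 : Real.exp (-y + 1) < Real.exp 2 := Real.exp_lt_exp.2 (by linarith [hy.1])
        have h3 : Real.exp 2 = Real.exp 1 * Real.exp 1 := by rw [← Real.exp_add]; norm_num
        have := Real.exp_one_lt_d9
        nlinarith [Real.exp_pos 1]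
      have h4 : Real.exp (-y) = Real.exp (-y + 1) * Real.exp (-1) := by
        rw [← Real.exp_add]; congr 1; ring
      rw [h4, ← mul_assoc]
      have : -y * Real.exp (-y + 1) < 1 := by nlinarith [hy.1, Real.exp_pos (-y + 1)]
      nlinarith [Real.exp_pos (-1)]
  have han : AnalyticOnNhd ℝ (fun y : ℝ => treeT (y * Complex.exp (-y)))
      (Set.Ioo (-(1 / 8)) 1) := by
    intro y hy
    have h1 : AnalyticAt ℂ (fun w : ℂ => treeT (w * Complex.exp (-w))) (y : ℂ) :=
      AnalyticAt.fun_comp (analyticAt_treeT (hlt y hy)) (by fun_prop)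
    exact AnalyticAt.fun_comp (f := fun y : ℝ => (y : ℂ)) h1.restrictScalars
      (Complex.ofRealCLM.analyticAt y)
  have han' : AnalyticOnNhd ℝ (fun y : ℝ => (y : ℂ)) (Set.Ioo (-(1 / 8)) 1) :=
    fun y _ => Complex.ofRealCLM.analyticAt y
  refine han.eqOn_of_preconnected_of_eventuallyEq han' isPreconnected_Ioo
    (z₀ := 0) (by norm_num) ?_ ⟨by linarith, hx1⟩
  have : Tendsto (fun y : ℝ => (y : ℂ)) (𝓝 0) (𝓝 0) := by
    simpa using Complex.continuous_ofReal.tendsto 0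
  exact this.eventually eventually_treeT_mul_exp_neg

lemma hasDerivAt_treeT {x : ℝ} (hx0 : 0 < x) (hx1 : x < 1) :
    HasDerivAt treeT (Complex.exp x / (1 - x)) (x * Complex.exp (-x)) := by
  have hlt : ‖(x : ℂ) * Complex.exp (-x)‖ < Real.exp (-1) := by
    rw [norm_mul_exp_neg, abs_of_pos hx0]; exact mul_exp_neg_lt hx1.ne
  have hT := (analyticAt_treeT hlt).differentiableAt.hasDerivAt
  have hf : HasDerivAt (fun w : ℂ => w * Complex.exp (-w)) ((1 - x) * Complex.exp (-x)) (x : ℂ) := by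
    have := (hasDerivAt_id (x : ℂ)).mul ((hasDerivAt_id (x : ℂ)).neg.cexp)
    convert! this using 1
    simp; ring
  have hcomp := (HasDerivAt.comp (x : ℂ) hT hf).comp_ofReal
  have hid : HasDerivAt (fun y : ℝ => (y : ℂ)) 1 x := (hasDerivAt_id (x : ℂ)).comp_ofReal
  have heq : (fun y : ℝ => (treeT ∘ fun w : ℂ => w * Complex.exp (-w)) (y : ℂ))
      =ᶠ[𝓝 x] fun y : ℝ => (y : ℂ) := by
    filter_upwards [Ioo_mem_nhds hx0 hx1] with y hy
    exact treeT_mul_exp_neg_ofReal hy.1.le hy.2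
  have h1 := hcomp.unique (hid.congr_of_eventuallyEq heq)
  have hne : (1 - (x : ℂ)) ≠ 0 := by
    rw [sub_ne_zero]; exact_mod_cast hx1.ne'
  convert! hT using 1
  rw [div_eq_iff hne]
  have he : Complex.exp (x : ℂ) * Complex.exp (-x) = 1 := by rw [← Complex.exp_add]; simp
  calc Complex.exp (x : ℂ) = Complex.exp x *
        (deriv treeT (x * Complex.exp (-x)) * ((1 - x) * Complex.exp (-x))) := by rw [h1, mul_one]
    _ = deriv treeT (x * Complex.exp (-x)) * (1 - x) * (Complex.exp x * Complex.exp (-x)) := by ring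
    _ = _ := by rw [he, mul_one]

/-! ### Overflows as natural numbers -/

/-- The overflow as a natural number (`0` if it is infinite). -/
noncomputable def overflowNat (b : ℕ) (x : ℤ → ℕ) (i : ℤ) : ℕ := (overflow b x i).toNat

/-- The number of keys that try bucket `i`, as a natural number. -/
noncomputable def profileNat (b : ℕ) (x : ℤ → ℕ) (i : ℤ) : ℕ := x i + overflowNat b x (i - 1)

/-- This is Lindley's recursion `Q_i = (X_i + Q_{i-1} - b)⁺`. A finite supremum of integers is
attained, and the maximising interval is extended by bucket `i`; if its untruncated surplus is
negative, then `q = 0` and bucket `i` alone is used. -/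
lemma overflow_eq_of_eq_coe {b : ℕ} {x : ℤ → ℕ} {i : ℤ} {q : ℕ}
    (h : overflow b x (i - 1) = (q : ℕ∞)) : overflow b x i = ((x i + q - b : ℕ) : ℕ∞) := by
  have hle : ∀ N : ℕ, (∑ k ∈ Finset.range N, x (i - 1 - (k : ℤ))) - b * N ≤ q := by
    intro N
    have := le_iSup (fun N : ℕ =>
      (((∑ k ∈ Finset.range N, x (i - 1 - (k : ℤ))) - b * N : ℕ) : ℕ∞)) N
    exact_mod_cast this.trans_eq h
  refine le_antisymm (iSup_le fun N => ?_) ?_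
  · cases N with
    | zero => simp
    | succ N =>
      rw [sum_range_succ_sub]
      have := hle N
      exact_mod_cast (by rw [mul_add]; omega)
  · have hatt : ∃ N : ℕ, (((∑ k ∈ Finset.range N, x (i - 1 - (k : ℤ))) - b * N : ℕ) : ℕ∞)
        = overflow b x (i - 1) :=
      ENat.exists_eq_iSup_of_lt_top (by rw [← overflow, h]; exact ENat.natCast_lt_top q)
    obtain ⟨N, hN⟩ := hatt
    rw [h] at hN
    have hN' : (∑ k ∈ Finset.range N, x (i - 1 - (k : ℤ))) - b * N = q := by exact_mod_cast hN
    by_cases h0 : b * N ≤ ∑ k ∈ Finset.range N, x (i - 1 - (k : ℤ))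
    · refine le_trans ?_ (le_iSup (fun N : ℕ =>
        (((∑ k ∈ Finset.range N, x (i - (k : ℤ))) - b * N : ℕ) : ℕ∞)) (N + 1))
      rw [sum_range_succ_sub]
      exact_mod_cast (by rw [mul_add]; omega)
    · refine le_trans ?_ (le_iSup (fun N : ℕ =>
        (((∑ k ∈ Finset.range N, x (i - (k : ℤ))) - b * N : ℕ) : ℕ∞)) 1)
      exact_mod_cast (by simp; omega)

section Good

variable {b : ℕ} {x : ℤ → ℕ} (hx : ∀ i, overflow b x i ≠ ⊤)
include hx

lemma coe_overflowNat (i : ℤ) : (overflowNat b x i : ℕ∞) = overflow b x i :=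
  ENat.natCast_toNat (hx i)

lemma overflowNat_eq (i : ℤ) : overflowNat b x i = profileNat b x i - b := by
  rw [overflowNat, overflow_eq_of_eq_coe (coe_overflowNat hx (i - 1)).symm]; rfl

lemma isFull_iff_le_profileNat (hb : 1 ≤ b) (i : ℤ) : IsFull b x i ↔ b ≤ profileNat b x i := by
  rw [← le_profile_iff hb, profile, ← coe_overflowNat hx, profileNat]
  exact_mod_cast Iff.rfl

end Good

/-- If no interval of length at least `k` ending at `i` is overcrowded, the overflow is at most the
number of keys in `k` buckets. Infinite overflow therefore needs arbitrarily long overcrowded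
intervals. -/
lemma HasGeometricTail.ae_overflow_ne_top {b : ℕ} {ρ : ℝ} {ν : Measure (ℤ → ℕ)}
    (h : HasGeometricTail b ρ ν) (h0 : 0 ≤ ρ) (h1 : ρ < 1) :
    ∀ᵐ x ∂ν, ∀ i, overflow b x i ≠ ⊤ := by
  rw [ae_all_iff]
  intro i
  rw [ae_iff]
  refine le_antisymm (ge_of_tendsto' (x := atTop)
    (f := fun k : ℕ => ENNReal.ofReal (ρ ^ k * (1 - ρ)⁻¹)) ?_ fun k => ?_) bot_le
  · have := ((tendsto_pow_atTop_nhds_zero_of_lt_one h0 h1).mul_const ((1 - ρ)⁻¹))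
    simpa using ENNReal.tendsto_ofReal this
  · refine (measure_mono fun x hx => ?_).trans (h.exists_le h0 h1 i k)
    simp only [Set.mem_ofPred_eq, not_not] at hx ⊢
    by_contra! hc
    have : overflow b x i ≤ ((∑ k ∈ Finset.range k, x (i - (k : ℤ)) : ℕ) : ℕ∞) := by
      refine iSup_le fun N => ?_
      rcases le_total k N with hk | hk
      · rw [Nat.sub_eq_zero_of_le (hc N hk).le]; simp
      · have := Finset.sum_le_sum_of_subset (f := fun j : ℕ => x (i - (j : ℤ)))
          (Finset.range_subset_range.2 hk)
        exact_mod_cast (Nat.sub_le _ _).trans this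
    rw [hx, top_le_iff] at this
    exact ENat.natCast_ne_top _ this

lemma measurable_overflowNat (b : ℕ) (i : ℤ) : Measurable fun x => overflowNat b x i := by
  set a : ℕ → (ℤ → ℕ) → ℕ := fun N x => (∑ k ∈ Finset.range N, x (i - (k : ℤ))) - b * N with ha
  have hmeas : ∀ N, Measurable (a N) := fun N =>
    (Measurable.of_discrete (f := fun s : ℕ => s - b * N)).comp
      (Finset.measurable_fun_sum _ fun _ _ => measurable_pi_apply _)
  have hle : ∀ x (k : ℕ), overflow b x i ≤ k ↔ ∀ N, a N x ≤ k := fun x k => by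
    rw [overflow, iSup_le_iff]
    exact forall_congr' fun N => Nat.cast_le
  refine measurable_of_Iic fun k => ?_
  -- The second set collects the infinite overflows, for which `toNat` returns `0`.
  have : (fun x => overflowNat b x i) ⁻¹' Set.Iic k
      = (⋂ N, {x | a N x ≤ k}) ∪ ⋂ l : ℕ, ⋃ N, {x | l < a N x} := by
    ext x
    simp only [Set.mem_preimage, Set.mem_Iic, Set.mem_union, Set.mem_iInter, Set.mem_iUnion,
      Set.mem_ofPred_eq]
    rw [← hle]
    rcases eq_or_ne (overflow b x i) ⊤ with h | h
    · have h2 : ∀ l : ℕ, ∃ N, l < a N x := by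
        intro l
        by_contra! hc
        rw [← hle, h, top_le_iff] at hc
        exact ENat.natCast_ne_top _ hc
      simp [overflowNat, h, h2]
    · obtain ⟨q, hq⟩ := ENat.ne_top_iff_exists.1 h
      have h2 : ¬ ∀ l : ℕ, ∃ N, l < a N x := by
        push Not
        exact ⟨q, (hle x q).1 hq.symm.le⟩
      simp [overflowNat, ← hq, h2]
  rw [this]
  exact (MeasurableSet.iInter fun N => measurableSet_le (hmeas N) measurable_const).union
    (MeasurableSet.iInter fun l => MeasurableSet.iUnion fun N =>
      measurableSet_lt measurable_const (hmeas N))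

lemma measurable_profileNat (b : ℕ) (i : ℤ) : Measurable fun x => profileNat b x i :=
  (measurable_pi_apply i).add (measurable_overflowNat b (i - 1))

/-! ### Independence of the past, and stationarity -/

/-- The configuration in which only the buckets before `k` receive keys. -/
def past (k : ℤ) (x : ℤ → ℕ) (i : ℤ) : ℕ := if i < k then x i else 0

lemma sum_past (k : ℤ) (x : ℤ → ℕ) {i : ℤ} (hi : i < k) (N : ℕ) :
    ∑ j ∈ Finset.range N, past k x (i - (j : ℤ)) = ∑ j ∈ Finset.range N, x (i - (j : ℤ)) :=
  Finset.sum_congr rfl fun j _ => if_pos (by omega)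

lemma overflowNat_past (b : ℕ) (k : ℤ) (x : ℤ → ℕ) {i : ℤ} (hi : i < k) :
    overflowNat b (past k x) i = overflowNat b x i := by
  simp only [overflowNat, overflow, sum_past k x hi]

lemma isFull_past (b : ℕ) (k : ℤ) (x : ℤ → ℕ) {i : ℤ} (hi : i < k) :
    IsFull b (past k x) i ↔ IsFull b x i := by
  simp only [IsFull, sum_past k x hi]

lemma indepFun_past_eval (b : ℕ) (α : ℝ) (k : ℤ) :
    IndepFun (past k) (fun x : ℤ → ℕ => x k) (poissonModel b α) := by
  set mc : ℤ → MeasurableSpace (ℤ → ℕ) := fun i =>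
    MeasurableSpace.comap (fun x : ℤ → ℕ => x i) inferInstance with hmc
  have hind : iIndep mc (poissonModel b α) := (iIndepFun_poissonModel b α (fun n => n)).iIndep
  have hle : ∀ i, mc i ≤ MeasurableSpace.pi := fun i => (measurable_pi_apply i).comap_le
  have h := indep_iSup_of_disjoint hle hind (S := Set.Iio k) (T := {k}) (by simp)
  rw [IndepFun_iff_Indep]
  refine indep_of_indep_of_le_right (indep_of_indep_of_le_left h ?_) ?_
  · refine Measurable.comap_le ?_
    refine @measurable_pi_iff _ _ _ (⨆ i ∈ Set.Iio k, mc i) _ _ |>.2 fun i => ?_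
    by_cases hi : i < k
    · have : (fun x : ℤ → ℕ => past k x i) = fun x => x i := by funext x; exact if_pos hi
      rw [this]
      exact (comap_measurable (fun x : ℤ → ℕ => x i)).mono
        (le_iSup₂_of_le (f := fun i (_ : i ∈ Set.Iio k) => mc i) i hi le_rfl) le_rfl
    · have : (fun x : ℤ → ℕ => past k x i) = fun _ => 0 := by funext x; exact if_neg hi
      rw [this]
      exact measurable_const
  · exact le_iSup₂_of_le (f := fun i (_ : i ∈ ({k} : Set ℤ)) => mc i) k rfl le_rfl

/-- A variable unchanged by erasing the counts from `k` on is a function of the past, hence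
independent of `x k`, whose generating function factors out. -/
lemma integral_mul_pow_of_past {b : ℕ} {α : ℝ} (hα : 0 ≤ α) (k : ℤ) {Z : (ℤ → ℕ) → ℂ}
    (hZ : Measurable Z) (hpast : ∀ x, Z (past k x) = Z x) (z : ℂ) :
    ∫ x, Z x * z ^ x k ∂(poissonModel b α)
      = (∫ x, Z x ∂(poissonModel b α)) * Complex.exp (b * α * (z - 1)) := by
  have hz : Measurable fun n : ℕ => z ^ n := Measurable.of_discrete
  have hpm : Measurable (past k) := measurable_pi_iff.2 fun i => by
    unfold past
    by_cases hi : i < k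
    · simpa [hi] using measurable_pi_apply i
    · simp [hi]
  have hi := (indepFun_past_eval b α k).comp hZ hz
  have h := hi.integral_fun_mul_eq_mul_integral
    (hZ.comp hpm).aestronglyMeasurable (hz.comp (measurable_pi_apply k)).aestronglyMeasurable
  simp only [Function.comp, hpast] at h
  rw [h]
  congr 1
  have h2 := integral_map (μ := poissonModel b α) (φ := fun x : ℤ → ℕ => x k)
    (f := fun n : ℕ => z ^ n) (measurable_pi_apply _).aemeasurable hz.aestronglyMeasurable
  rw [(measurePreserving_eval_poissonModel b α k).map_eq, integral_pow_poissonMeasure] at h2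
  rw [← h2]
  have : 0 ≤ (b : ℝ) * α := by positivity
  rw [← Complex.ofReal_natCast, ← Complex.ofReal_mul]
  congr 2
  exact_mod_cast Real.coe_toNNReal _ this

/-- The product measure is invariant under the shift of the buckets. -/
lemma integral_pow_overflowNat_succ (b : ℕ) (α : ℝ) (z : ℂ) (i : ℤ) :
    ∫ x, z ^ overflowNat b x (i + 1) ∂(poissonModel b α)
      = ∫ x, z ^ overflowNat b x i ∂(poissonModel b α) := by
  have hmap : (poissonModel b α).map (fun x i => x (i + 1)) = poissonModel b α :=
    Measure.map_infinitePi_infinitePi_of_inj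
      (P := fun _ : ℤ => poissonMeasure ((b : ℝ) * α).toNNReal) (f := fun i : ℤ => i + 1)
      (add_left_injective 1)
  have hz : Measurable fun x => z ^ overflowNat b x i :=
    (Measurable.of_discrete (f := fun n : ℕ => z ^ n)).comp (measurable_overflowNat b i)
  conv_rhs => rw [← hmap]
  rw [integral_map (measurable_pi_iff.2 fun i => measurable_pi_apply _).aemeasurable
    hz.aestronglyMeasurable]
  refine integral_congr_ae (Eventually.of_forall fun x => ?_)
  simp only [overflowNat, overflow]
  have : ∀ k : ℕ, x (i + 1 - (k : ℤ)) = x (i - (k : ℤ) + 1) := fun k => by congr 1; ring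
  simp only [this]

/-! ### The functional equation for the generating function -/

/-- The probability that the buckets `0, …, k - 1` are full and `j` keys try bucket `k`. -/
noncomputable def fullProb (b : ℕ) (α : ℝ) (k j : ℕ) : ℝ :=
  (poissonModel b α).real {x | (∀ i < k, IsFull b x (i : ℕ)) ∧ profileNat b x k = j}

/-- `E [z ^ Q_{k-1}; buckets 0, …, k - 1 are full]`. -/
noncomputable def fullGen (b : ℕ) (α : ℝ) (z : ℂ) (k : ℕ) : ℂ :=
  ∫ x, {x : ℤ → ℕ | ∀ i < k, IsFull b x (i : ℕ)}.indicator
    (fun x => z ^ overflowNat b x (k - 1)) x ∂(poissonModel b α)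

lemma measurableSet_fullProb (b k j : ℕ) :
    MeasurableSet {x : ℤ → ℕ | (∀ i < k, IsFull b x (i : ℕ)) ∧ profileNat b x k = j} :=
  (measurableSet_allFull b k).inter (measurable_profileNat b k (measurableSet_singleton j))

lemma measurable_pow_overflowNat (b : ℕ) (z : ℂ) (i : ℤ) :
    Measurable fun x => z ^ overflowNat b x i :=
  (Measurable.of_discrete (f := fun n : ℕ => z ^ n)).comp (measurable_overflowNat b i)

section FunctionalEquation

variable {b : ℕ} {α : ℝ} {z : ℂ}

lemma norm_indicator_pow_le (hz : ‖z‖ ≤ 1) (S : Set (ℤ → ℕ)) (f : (ℤ → ℕ) → ℕ) (x : ℤ → ℕ) :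
    ‖S.indicator (fun x => z ^ f x) x‖ ≤ 1 := by
  refine (norm_indicator_le_norm_self _ _).trans ?_
  rw [norm_pow]
  exact pow_le_one₀ (norm_nonneg _) hz

lemma integrable_fullGen (hz : ‖z‖ ≤ 1) (k : ℕ) (i : ℤ) :
    Integrable ({x : ℤ → ℕ | ∀ i < k, IsFull b x (i : ℕ)}.indicator
      fun x => z ^ overflowNat b x i) (poissonModel b α) :=
  Integrable.of_bound (((measurable_pow_overflowNat b z i).indicator
    (measurableSet_allFull b k)).aestronglyMeasurable) 1
    (Eventually.of_forall fun x => norm_indicator_pow_le hz _ _ x)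

lemma norm_fullGen_le (hz : ‖z‖ ≤ 1) (k : ℕ) : ‖fullGen b α z k‖ ≤ 1 := by
  refine (norm_integral_le_of_norm_le_const (C := 1)
    (Eventually.of_forall fun x => norm_indicator_pow_le hz _ _ x)).trans ?_
  simp

lemma integral_indicator_fullProb (k j : ℕ) (c : ℂ) :
    ∫ x, {x : ℤ → ℕ | (∀ i < k, IsFull b x (i : ℕ)) ∧ profileNat b x k = j}.indicator
      (fun _ => c) x ∂(poissonModel b α) = fullProb b α k j * c := by
  rw [integral_indicator_const _ (measurableSet_fullProb b k j), Complex.real_smul]; rfl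

lemma integrable_indicator_fullProb (k j : ℕ) (c : ℂ) :
    Integrable ({x : ℤ → ℕ | (∀ i < k, IsFull b x (i : ℕ)) ∧ profileNat b x k = j}.indicator
      fun _ => c) (poissonModel b α) :=
  (integrable_const c).indicator (measurableSet_fullProb b k j)

/-- Both sides compute `E[z ^ H_k; buckets 0, …, k-1 full]`, with `H_k = X_k + Q_{k-1}`. On the
right it is split according to whether bucket `k` is full: if `H_k ≥ b`, then `H_k = b + Q_k`. -/
lemma fullGen_mul_exp (hb : 1 ≤ b) (hα : 0 ≤ α)
    (hgood : ∀ᵐ x ∂(poissonModel b α), ∀ i, overflow b x i ≠ ⊤) (hz : ‖z‖ ≤ 1) (k : ℕ) :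
    fullGen b α z k * Complex.exp (b * α * (z - 1))
      = ∑ j ∈ Finset.range b, fullProb b α k j * z ^ j + z ^ b * fullGen b α z (k + 1) := by
  have hpast : ∀ x, {x : ℤ → ℕ | ∀ i < k, IsFull b x (i : ℕ)}.indicator
      (fun x => z ^ overflowNat b x (k - 1)) (past k x) =
      {x : ℤ → ℕ | ∀ i < k, IsFull b x (i : ℕ)}.indicator
      (fun x => z ^ overflowNat b x (k - 1)) x := by
    intro x
    have h1 : past k x ∈ {x : ℤ → ℕ | ∀ i < k, IsFull b x (i : ℕ)}
        ↔ x ∈ {x : ℤ → ℕ | ∀ i < k, IsFull b x (i : ℕ)} :=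
      forall₂_congr fun i hi => isFull_past b k x (by exact_mod_cast hi)
    by_cases hx : x ∈ {x : ℤ → ℕ | ∀ i < k, IsFull b x (i : ℕ)}
    · rw [Set.indicator_of_mem hx, Set.indicator_of_mem (h1.2 hx),
        overflowNat_past b k x (by omega)]
    · rw [Set.indicator_of_notMem hx, Set.indicator_of_notMem (fun h => hx (h1.1 h))]
  unfold fullGen
  rw [← integral_mul_pow_of_past hα k ((measurable_pow_overflowNat b z _).indicator
    (measurableSet_allFull b k)) hpast z]
  rw [Finset.sum_congr rfl fun j _ => (integral_indicator_fullProb (α := α) k j (z ^ j)).symm,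
    ← integral_finsetSum _ fun j _ => integrable_indicator_fullProb k j _,
    ← integral_const_mul, ← integral_add
      (integrable_finsetSum _ fun j _ => integrable_indicator_fullProb k j _)
      ((integrable_fullGen hz (k + 1) _).const_mul _)]
  refine integral_congr_ae ?_
  filter_upwards [hgood] with x hx
  classical
  simp only [Set.indicator_apply, Set.mem_ofPred_eq]
  have hfull := isFull_iff_le_profileNat hx hb k
  have hQ := overflowNat_eq hx k
  have hH : profileNat b x k = x k + overflowNat b x (k - 1) := rfl
  by_cases hE : ∀ i < k, IsFull b x (i : ℕ)
  · have hE' : (∀ i < k + 1, IsFull b x (i : ℕ)) ↔ b ≤ profileNat b x k := by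
      rw [← hfull]
      refine ⟨fun h => h k (Nat.lt_succ_self k), fun h i hi => ?_⟩
      rcases Nat.lt_succ_iff_lt_or_eq.1 hi with h' | rfl
      · exact hE i h'
      · exact h
    have hE1 : (∀ i < k, IsFull b x (i : ℕ)) = True := eq_true hE
    simp only [hE', hE1, true_and, if_true]
    rw [Finset.sum_ite_eq, ← pow_add, add_comm (overflowNat b x _), ← hH]
    by_cases hlt : b ≤ profileNat b x k
    · rw [if_neg (by simpa using hlt), if_pos hlt, zero_add, ← pow_add]
      congr 1
      push_cast
      rw [add_sub_cancel_right, hQ]; omega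
    · rw [if_pos (by simpa using hlt), if_neg hlt, mul_zero, add_zero]
  · have hE' : ¬ ∀ i < k + 1, IsFull b x (i : ℕ) := fun h => hE fun i hi => h i (by omega)
    simp only [hE, hE', false_and, if_false]
    simp

/-- By stationarity `Q_{-1}` may be replaced by `Q_0`, which is `0` when bucket `0` is not full.
This closes the recursion. -/
lemma fullGen_zero (hb : 1 ≤ b)
    (hgood : ∀ᵐ x ∂(poissonModel b α), ∀ i, overflow b x i ≠ ⊤) (hz : ‖z‖ ≤ 1) :
    fullGen b α z 0 = ∑ j ∈ Finset.range b, (fullProb b α 0 j : ℂ) + fullGen b α z 1 := by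
  have h0 : fullGen b α z 0 = ∫ x, z ^ overflowNat b x 0 ∂(poissonModel b α) := by
    have := integral_pow_overflowNat_succ b α z (-1)
    rw [show (-1 : ℤ) + 1 = 0 by norm_num] at this
    rw [this]
    simp [fullGen]
  rw [h0]
  have h1 : ∀ j ∈ Finset.range b, (fullProb b α 0 j : ℂ) = _ := fun j _ =>
    (mul_one _).symm.trans (integral_indicator_fullProb 0 j 1).symm
  unfold fullGen
  rw [Finset.sum_congr rfl h1, ← integral_finsetSum _ fun j _ => integrable_indicator_fullProb 0 j _, ← integral_add
      (integrable_finsetSum _ fun j _ => integrable_indicator_fullProb 0 j _)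
      (integrable_fullGen hz 1 _)]
  refine integral_congr_ae ?_
  filter_upwards [hgood] with x hx
  classical
  simp only [Set.indicator_apply, Set.mem_ofPred_eq]
  have hfull := isFull_iff_le_profileNat hx hb 0
  have hQ := overflowNat_eq hx 0
  simp only [Nat.lt_one_iff, forall_eq, not_lt_zero, IsEmpty.forall_iff, implies_true, true_and,
    Nat.cast_zero, Nat.cast_one, sub_self, hfull]
  rw [Finset.sum_ite_eq]
  by_cases hlt : b ≤ profileNat b x 0
  · rw [if_neg (by simpa using hlt), if_pos hlt, zero_add]
  · rw [if_pos (by simpa using hlt), if_neg hlt, hQ, Nat.sub_eq_zero_of_le (by omega)]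
    simp

lemma sum_fullProb (hb : 1 ≤ b) {ρ : ℝ} (h0 : 0 ≤ ρ) (h1 : ρ < 1)
    (h : HasGeometricTail b ρ (poissonModel b α)) (k : ℕ) :
    ∑ j ∈ Finset.range b, fullProb b α k j = ((poissonModel b α).map (infiniteU b)).real {k} := by
  have hdis : Set.PairwiseDisjoint (Finset.range b : Set ℕ) fun j : ℕ =>
      {x : ℤ → ℕ | (∀ i < k, IsFull b x (i : ℕ)) ∧ profileNat b x k = j} := by
    intro i _ j _ hij
    refine Set.disjoint_left.2 fun x hx hy => hij ?_
    exact hx.2.symm.trans hy.2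
  rw [map_measureReal_apply (measurable_infiniteU hb) (measurableSet_singleton k)]
  unfold fullProb
  rw [← measureReal_biUnion_finset hdis fun j _ => measurableSet_fullProb b k j]
  refine measureReal_congr ?_
  filter_upwards [h.ae_exists_not_isFull h0 h1, h.ae_overflow_ne_top h0 h1] with x hx hx'
  refine propext ?_
  change x ∈ (⋃ j ∈ Finset.range b, _) ↔ infiniteU b x = k
  simp only [Set.mem_iUnion, Finset.mem_range, Set.mem_ofPred_eq, exists_prop]
  have hfull := isFull_iff_le_profileNat hx' hb k
  have e1 := le_infiniteU_iff hb hx k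
  have e2 := le_infiniteU_iff hb hx (k + 1)
  rw [Nat.forall_lt_succ_right, ← e1, hfull] at e2
  rw [← e1]
  constructor
  · rintro ⟨j, hj, h1, rfl⟩; omega
  · intro h; exact ⟨_, by omega, by omega, rfl⟩

lemma fullProb_nonneg (k j : ℕ) : 0 ≤ fullProb b α k j := measureReal_nonneg

lemma fullProb_le_one (k j : ℕ) : fullProb b α k j ≤ 1 := measureReal_le_one

lemma summable_pow_mul_fullProb {q : ℂ} (hq : ‖q‖ < 1) (j : ℕ) :
    Summable fun k => q ^ k * (fullProb b α k j : ℂ) := by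
  refine Summable.of_norm_bounded (summable_geometric_of_lt_one (norm_nonneg q) hq) fun k => ?_
  rw [norm_mul, norm_pow, Complex.norm_real, Real.norm_of_nonneg (fullProb_nonneg k j)]
  exact mul_le_of_le_one_right (by positivity) (fullProb_le_one k j)

/-- At a root `z` of `z ^ b = q exp (b α (z - 1))`, the generating function of `U` and of the
contents of the first non-full bucket is determined by the contents of bucket `0`. -/
lemma kernel_equation (hb : 1 ≤ b) (hα : 0 ≤ α)
    (hgood : ∀ᵐ x ∂(poissonModel b α), ∀ i, overflow b x i ≠ ⊤) (hz : ‖z‖ ≤ 1) {q : ℂ}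
    (hq0 : q ≠ 0) (hq : ‖q‖ < 1) (hroot : z ^ b = q * Complex.exp (b * α * (z - 1))) :
    (∑ j ∈ Finset.range b, (fullProb b α 0 j : ℂ)) * z ^ b
      = ∑ j ∈ Finset.range b,
        (fullProb b α 0 j + (q - 1) * ∑' k, q ^ k * (fullProb b α k j : ℂ)) * z ^ j := by
  set e := Complex.exp (b * α * (z - 1)) with he
  set B : ℕ → ℂ := fun k => ∑ j ∈ Finset.range b, fullProb b α k j * z ^ j with hB
  set F := fullGen b α z with hF
  have hstep : ∀ k, F k * e = B k + z ^ b * F (k + 1) := fun k =>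
    fullGen_mul_exp hb hα hgood hz k
  -- At the root, multiplying the recursion by `q` turns `exp (b α (z - 1))` into `z ^ b`, so `z ^ b
  -- F_k = q B_k + q z ^ b F_{k+1}`, which can be iterated.
  have htel : ∀ K, z ^ b * F 0 = ∑ k ∈ Finset.range K, q ^ (k + 1) * B k
      + q ^ K * (z ^ b * F K) := by
    intro K
    induction K with
    | zero => simp
    | succ K ih =>
      rw [ih, Finset.sum_range_succ, add_assoc]
      congr 1
      have := hstep K
      rw [hroot] at this ⊢
      linear_combination (q ^ K * q) * this
  have hBj : ∀ k, q ^ (k + 1) * B k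
      = ∑ j ∈ Finset.range b, q * (q ^ k * (fullProb b α k j : ℂ)) * z ^ j := by
    intro k
    rw [hB, Finset.mul_sum]
    exact Finset.sum_congr rfl fun j _ => by ring
  have hBsum : HasSum (fun k => q ^ (k + 1) * B k)
      (∑ j ∈ Finset.range b, q * (∑' k, q ^ k * (fullProb b α k j : ℂ)) * z ^ j) := by
    simp_rw [hBj]
    exact hasSum_sum fun j _ => ((summable_pow_mul_fullProb hq j).hasSum.mul_left q).mul_right _
  have hrest : Tendsto (fun K => q ^ K * (z ^ b * F K)) atTop (𝓝 0) := by
    refine squeeze_zero_norm (fun K => ?_) (tendsto_pow_atTop_nhds_zero_of_lt_one (norm_nonneg q) hq)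
    rw [norm_mul, norm_mul, norm_pow, norm_pow]
    refine mul_le_of_le_one_right (by positivity) (mul_le_one₀ (pow_le_one₀ (norm_nonneg _) hz)
      (norm_nonneg _) (norm_fullGen_le hz K))
  have hlim : z ^ b * F 0
      = ∑ j ∈ Finset.range b, q * (∑' k, q ^ k * (fullProb b α k j : ℂ)) * z ^ j := by
    have h := hBsum.tendsto_sum_nat.add hrest
    rw [add_zero] at h
    exact tendsto_nhds_unique (tendsto_const_nhds.congr htel) h
  have hstat := fullGen_zero hb hgood hz
  have h0 := hstep 0
  rw [← hF] at hstat
  refine mul_left_cancel₀ hq0 ?_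
  have hR : q * ∑ j ∈ Finset.range b,
        (fullProb b α 0 j + (q - 1) * ∑' k, q ^ k * (fullProb b α k j : ℂ)) * z ^ j
      = q * B 0 + (q - 1) * (z ^ b * F 0) := by
    rw [hlim, hB, Finset.mul_sum, Finset.mul_sum, Finset.mul_sum, ← Finset.sum_add_distrib]
    exact Finset.sum_congr rfl fun j _ => by ring
  rw [hR]
  -- Stationarity and the first step of the recursion eliminate `F 1`; the root equation then
  -- replaces `q e` by `z ^ b`.
  linear_combination (-q * z ^ b) * hstat + q * h0 + F 0 * hroot

end FunctionalEquation

/-! ### A polynomial identity -/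

/-- The polynomial `c X ^ b - ∑ d_j X ^ j` vanishes at `b` distinct points, so it equals `c ∏ (X -
ζ_l)`: the difference has degree below `b` and `b` zeros. The claim is its value at `1`. -/
lemma sub_sum_eq_mul_prod {b : ℕ} (c : ℂ) (d : ℕ → ℂ) (ζ : ℕ → ℂ)
    (hinj : Set.InjOn ζ (Finset.range b))
    (h : ∀ l < b, c * ζ l ^ b = ∑ j ∈ Finset.range b, d j * ζ l ^ j) :
    c - ∑ j ∈ Finset.range b, d j = c * ∏ l ∈ Finset.range b, (1 - ζ l) := by
  open Polynomial in
  set P : ℂ[X] := ∏ l ∈ Finset.range b, (X - C (ζ l)) with hP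
  set D : ℂ[X] := ∑ j ∈ Finset.range b, C (d j) * X ^ j with hD
  have hPm : P.Monic := monic_prod_of_monic _ _ fun l _ => monic_X_sub_C _
  have hPd : P.degree = b := by simp [hP, degree_prod]
  have hDd : D.degree < b := by
    rw [← mem_degreeLT]
    refine Submodule.sum_mem _ fun j hj => mem_degreeLT.2 ?_
    exact (degree_C_mul_X_pow_le _ _).trans_lt (by exact_mod_cast Finset.mem_range.1 hj)
  have hsub : (X ^ b - P).degree < (b : WithBot ℕ) := by
    have := degree_sub_lt_left (p := (X ^ b : ℂ[X])) (q := P) (by rw [hPd, degree_X_pow])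
      (pow_ne_zero _ X_ne_zero) (by rw [hPm.leadingCoeff, leadingCoeff_X_pow])
    rwa [degree_X_pow] at this
  have hdeg : (C c * X ^ b - D - C c * P).degree < ((Finset.range b).card : WithBot ℕ) := by
    rw [Finset.card_range, show C c * X ^ b - D - C c * P = C c * (X ^ b - P) - D by ring]
    refine (degree_sub_le _ _).trans_lt (max_lt ?_ hDd)
    rw [← smul_eq_C_mul]
    exact (degree_smul_le _ _).trans_lt hsub
  have heq := Polynomial.eq_of_degree_sub_lt_of_eval_index_eq (Finset.range b) hinj hdeg fun l hl => by
    have h1 : P.eval (ζ l) = 0 := by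
      rw [hP, eval_prod]; exact Finset.prod_eq_zero hl (by simp)
    have h2 : D.eval (ζ l) = ∑ j ∈ Finset.range b, d j * ζ l ^ j := by simp [hD, eval_finsetSum]
    rw [eval_sub, eval_mul, eval_mul, h1, h2, ← h l (Finset.mem_range.1 hl)]
    simp
  have := congrArg (eval 1) heq
  simpa [hD, hP, eval_finsetSum, eval_prod] using this

/-! ### The generating function of `U` -/

/-- The power series of the generating function of `U`. -/
noncomputable def genU (b : ℕ) (α : ℝ) (q : ℂ) : ℂ :=
  ∑' k, q ^ k * (((poissonModel b α).map (infiniteU b)).real {k} : ℂ)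

/-- The argument of the tree function in `zetaRoot`. -/
noncomputable def zetaArg (b : ℕ) (α : ℝ) (r : ℂ) (l : ℕ) : ℂ :=
  Complex.exp (2 * (Real.pi : ℂ) * Complex.I / (b : ℂ)) ^ l *
    ((α : ℂ) * Complex.exp (-(α : ℂ)) * r)

lemma zetaRoot_eq (b : ℕ) (α : ℝ) (r : ℂ) (l : ℕ) :
    zetaRoot b α r l = treeT (zetaArg b α r l) / α := rfl

/-! ### The product formula near `r = 0`, up to a constant -/

section Local

variable {b : ℕ} {α : ℝ}

lemma continuous_zetaArg (l : ℕ) : Continuous fun r => zetaArg b α r l := by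
  unfold zetaArg; fun_prop

/-- With `T = α ζ`, the equation `T exp (-T) = w` reads `ζ = ω ^ l r exp (α (ζ - 1))`; the `b`-th
power removes the root of unity. -/
lemma pow_zetaRoot_eq (hb : 1 ≤ b) (hα : 0 < α) {r : ℂ} {l : ℕ}
    (h : treeT (zetaArg b α r l) * Complex.exp (-treeT (zetaArg b α r l)) = zetaArg b α r l) :
    zetaRoot b α r l ^ b = r ^ b * Complex.exp (b * α * (zetaRoot b α r l - 1)) := by
  have hα' : (α : ℂ) ≠ 0 := by exact_mod_cast hα.ne'
  set ω := Complex.exp (2 * (Real.pi : ℂ) * Complex.I / (b : ℂ)) with hω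
  have hprim : IsPrimitiveRoot ω b := Complex.isPrimitiveRoot_exp b (by omega)
  set ζ := zetaRoot b α r l with hζ
  have hT : treeT (zetaArg b α r l) = α * ζ := by
    rw [hζ, zetaRoot_eq, mul_div_cancel₀ _ hα']
  rw [hT] at h
  have h1 : ζ = ω ^ l * r * Complex.exp (α * (ζ - 1)) := by
    have he : Complex.exp (α * (ζ - 1)) = Complex.exp (α * ζ) * Complex.exp (-α) := by
      rw [← Complex.exp_add]; congr 1; ring
    have he' : Complex.exp (-(α * ζ)) * Complex.exp (α * ζ) = 1 := by
      rw [← Complex.exp_add]; simp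
    refine mul_left_cancel₀ hα' ?_
    rw [he]
    calc (α : ℂ) * ζ = α * ζ * Complex.exp (-(α * ζ)) * Complex.exp (α * ζ) := by
          rw [mul_assoc _ (Complex.exp _), he', mul_one]
      _ = _ := by rw [h, zetaArg]; ring
  conv_lhs => rw [h1]
  rw [mul_pow, mul_pow, ← pow_mul, mul_comm l b, pow_mul, hprim.pow_eq_one, one_pow, one_mul,
    ← Complex.exp_nat_mul]
  congr 2; ring

/-- The argument of the tree function is recovered from its value as `T exp (-T)`, and the arguments
differ because the powers of `ω` do. -/
lemma injOn_zetaRoot (hb : 1 ≤ b) (hα : 0 < α) {r : ℂ} (hr : r ≠ 0)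
    (h : ∀ l ∈ Finset.range b,
      treeT (zetaArg b α r l) * Complex.exp (-treeT (zetaArg b α r l)) = zetaArg b α r l) :
    Set.InjOn (zetaRoot b α r) (Finset.range b) := by
  have hα' : (α : ℂ) ≠ 0 := by exact_mod_cast hα.ne'
  have hprim := Complex.isPrimitiveRoot_exp b (by omega)
  intro l hl l' hl' heq
  have hT : treeT (zetaArg b α r l) = treeT (zetaArg b α r l') := by
    simpa [zetaRoot_eq, div_left_inj' hα'] using heq
  have h1 : zetaArg b α r l = zetaArg b α r l' := by rw [← h l hl, ← h l' hl', hT]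
  have h2 := mul_right_cancel₀ (mul_ne_zero (mul_ne_zero hα' (Complex.exp_ne_zero _)) hr) h1
  exact hprim.pow_inj (Finset.mem_range.1 hl) (Finset.mem_range.1 hl') h2

/-- Close to `0` the tree function inverts `z exp (-z)` and all roots lie in the unit disc, as the
kernel equation requires; `r ≠ 0` keeps them distinct. The constant is the probability that bucket
`0` is not full. -/
lemma exists_eventually_genU_eq (hb : 1 ≤ b) (hα : 0 < α) {ρ : ℝ} (h0 : 0 ≤ ρ) (h1 : ρ < 1)
    (h : HasGeometricTail b ρ (poissonModel b α)) :
    ∃ c : ℂ, ∀ᶠ r in 𝓝[≠] (0 : ℂ), (1 - r ^ b) * genU b α (r ^ b)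
      = c * ∏ l ∈ Finset.range b, (1 - zetaRoot b α r l) := by
  refine ⟨∑ j ∈ Finset.range b, (fullProb b α 0 j : ℂ), ?_⟩
  have hgood := h.ae_overflow_ne_top h0 h1
  have harg : ∀ l, Tendsto (fun r => zetaArg b α r l) (𝓝 0) (𝓝 0) := fun l => by
    simpa [zetaArg] using (continuous_zetaArg (b := b) (α := α) l).tendsto 0
  have hT : ∀ᶠ r in 𝓝 (0 : ℂ), ∀ l ∈ Finset.range b,
      treeT (zetaArg b α r l) * Complex.exp (-treeT (zetaArg b α r l)) = zetaArg b α r l :=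
    (Finset.eventually_all _).2 fun l _ => (harg l).eventually eventually_treeT_mul_exp_neg_treeT
  have hz : ∀ᶠ r in 𝓝 (0 : ℂ), ∀ l ∈ Finset.range b, ‖zetaRoot b α r l‖ ≤ 1 := by
    refine (Finset.eventually_all _).2 fun l _ => ?_
    have hc : ContinuousAt treeT 0 :=
      (analyticAt_treeT (by simpa using Real.exp_pos _)).continuousAt
    have h2 : Tendsto (fun r => ‖zetaRoot b α r l‖) (𝓝 0) (𝓝 0) := by
      have h3 : Tendsto treeT (𝓝 0) (𝓝 0) := by simpa [ContinuousAt, treeT_zero] using hc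
      simpa [zetaRoot_eq] using ((h3.comp (harg l)).div_const (α : ℂ)).norm
    exact ((tendsto_order.1 h2).2 1 one_pos).mono fun r hr => hr.le
  have hq : ∀ᶠ r in 𝓝 (0 : ℂ), ‖r‖ < 1 := by
    have : Tendsto (fun r : ℂ => ‖r‖) (𝓝 0) (𝓝 0) := by simpa using continuous_norm.tendsto (0 : ℂ)
    exact (tendsto_order.1 this).2 1 one_pos
  rw [eventually_nhdsWithin_iff]
  filter_upwards [hT, hz, hq] with r hT hz hq hr0
  have hr0 : r ≠ 0 := hr0
  have hqb : ‖r ^ b‖ < 1 := by rw [norm_pow]; exact pow_lt_one₀ (norm_nonneg _) hq (by omega)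
  rw [← sub_sum_eq_mul_prod _ _ _ (injOn_zetaRoot hb hα hr0 hT) fun l hl =>
    kernel_equation hb hα.le hgood (hz l (Finset.mem_range.2 hl)) (pow_ne_zero b hr0) hqb
      (pow_zetaRoot_eq hb hα (hT l (Finset.mem_range.2 hl)))]
  have hgen : genU b α (r ^ b)
      = ∑ j ∈ Finset.range b, ∑' k, (r ^ b) ^ k * (fullProb b α k j : ℂ) := by
    rw [genU, ← Summable.tsum_finsetSum fun j _ => summable_pow_mul_fullProb hqb j]
    refine tsum_congr fun k => ?_
    rw [← sum_fullProb hb h0 h1 h k, ← Finset.mul_sum]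
    push_cast; rfl
  rw [hgen, Finset.sum_add_distrib, ← Finset.mul_sum]
  ring

end Local

/-! ### Analytic continuation to a disc containing `1`, and the constant -/

section Global

variable {b : ℕ} {α s : ℝ}

lemma norm_zetaArg (hα : 0 < α) (r : ℂ) (l : ℕ) :
    ‖zetaArg b α r l‖ = α * Real.exp (-α) * ‖r‖ := by
  have h1 : ‖Complex.exp (2 * (Real.pi : ℂ) * Complex.I / (b : ℂ))‖ = 1 := by
    rw [show 2 * (Real.pi : ℂ) * Complex.I / (b : ℂ) = ((2 * Real.pi / b : ℝ) : ℂ) * Complex.I by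
      push_cast; ring]
    exact Complex.norm_exp_ofReal_mul_I _
  rw [zetaArg, norm_mul, norm_pow, h1, one_pow, one_mul, norm_mul, norm_mul, Complex.norm_real,
    Real.norm_of_nonneg hα.le, ← Complex.ofReal_neg, Complex.norm_exp_ofReal]

lemma differentiableOn_zetaRoot (hα : 0 < α) (hs : s ≤ Real.exp (α - 1) / α) (l : ℕ) :
    DifferentiableOn ℂ (fun r => zetaRoot b α r l) (Metric.ball 0 s) := by
  have : DifferentiableOn ℂ (fun r => treeT (zetaArg b α r l)) (Metric.ball 0 s) := by
    refine differentiableOn_treeT.comp (t := Metric.ball 0 (Real.exp (-1))) ?_ fun r hr => ?_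
    · unfold zetaArg; fun_prop
    · rw [mem_ball_zero_iff] at hr ⊢
      rw [norm_zetaArg hα]
      have h1 := hr.trans_le hs
      rw [lt_div_iff₀ hα] at h1
      calc α * Real.exp (-α) * ‖r‖ = ‖r‖ * α * Real.exp (-α) := by ring
        _ < Real.exp (α - 1) * Real.exp (-α) := by gcongr
        _ = Real.exp (-1) := by rw [← Real.exp_add]; congr 1; ring
  exact this.div_const _

lemma differentiableOn_genU {ρ C : ℝ} (h0 : 0 ≤ ρ)
    (h : ∀ k, ((poissonModel b α).map (infiniteU b)).real {k} ≤ C * ρ ^ k)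
    (hs0 : 0 ≤ s) (hs : ρ * s ^ b < 1) :
    DifferentiableOn ℂ (fun r => genU b α (r ^ b)) (Metric.ball 0 s) := by
  refine Complex.differentiableOn_tsum_of_summable_norm (u := fun k => C * (ρ * s ^ b) ^ k)
    ((summable_geometric_of_lt_one (by positivity) hs).mul_left C) (fun k => by fun_prop)
    Metric.isOpen_ball fun k r hr => ?_
  rw [mem_ball_zero_iff] at hr
  rw [norm_mul, norm_pow, norm_pow, Complex.norm_real, Real.norm_of_nonneg measureReal_nonneg,
    mul_pow]
  calc (‖r‖ ^ b) ^ k * ((poissonModel b α).map (infiniteU b)).real {k}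
      ≤ (s ^ b) ^ k * (C * ρ ^ k) := by
        have := h k
        gcongr
    _ = C * (ρ ^ k * (s ^ b) ^ k) := by ring

lemma genU_one (hb : 1 ≤ b) : genU b α 1 = 1 := by
  have hp : IsProbabilityMeasure ((poissonModel b α).map (infiniteU b)) :=
    Measure.isProbabilityMeasure_map (measurable_infiniteU hb).aemeasurable
  have h : ∫ _ : ℕ, (1 : ℂ) ∂((poissonModel b α).map (infiniteU b))
      = ∑' k, ((poissonModel b α).map (infiniteU b)).real {k} • (1 : ℂ) :=
    integral_countable (integrable_const 1)
  rw [integral_const, probReal_univ, one_smul] at h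
  refine Eq.trans ?_ h.symm
  simp [genU, Complex.real_smul]

lemma zetaRoot_one_zero (hα0 : 0 < α) (hα1 : α < 1) : zetaRoot b α 1 0 = 1 := by
  have hα' : (α : ℂ) ≠ 0 := by exact_mod_cast hα0.ne'
  simp [zetaRoot, treeT_mul_exp_neg_ofReal hα0.le hα1, hα']

lemma hasDerivAt_zetaRoot_zero (hα0 : 0 < α) (hα1 : α < 1) :
    HasDerivAt (fun r => zetaRoot b α r 0) (1 / (1 - α)) 1 := by
  have hα' : (α : ℂ) ≠ 0 := by exact_mod_cast hα0.ne'
  have h1 : HasDerivAt (fun r : ℂ => (α : ℂ) * Complex.exp (-α) * r)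
      ((α : ℂ) * Complex.exp (-α)) 1 := by
    simpa using (hasDerivAt_id (1 : ℂ)).const_mul ((α : ℂ) * Complex.exp (-α))
  have h2 := hasDerivAt_treeT hα0 hα1
  rw [show (α : ℂ) * Complex.exp (-α) = (α : ℂ) * Complex.exp (-α) * 1 by ring] at h2
  have h3 := (HasDerivAt.comp (1 : ℂ) h2 h1).div_const (α : ℂ)
  have he : Complex.exp α * Complex.exp (-α) = 1 := by rw [← Complex.exp_add]; simp
  convert! h3 using 1
  · funext r; simp [zetaRoot]
  · have hne : (1 - (α : ℂ)) ≠ 0 := by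
      rw [sub_ne_zero]; exact_mod_cast hα1.ne'
    field_simp
    exact he.symm

/-- The generating function of `U`, for all `q = r ^ b` with `‖r‖ < s`. -/
theorem one_sub_mul_genU (hb : 1 ≤ b) (hα0 : 0 < α) (hα1 : α < 1) {ρ : ℝ} (h0 : 0 ≤ ρ)
    (h1 : ρ < 1) (h : HasGeometricTail b ρ (poissonModel b α)) (hs1 : 1 < s)
    (hs : s ≤ Real.exp (α - 1) / α) (hρs : ρ * s ^ b < 1) {r : ℂ} (hr : ‖r‖ < s) :
    (1 - r ^ b) * genU b α (r ^ b)
      = tZero b α * ∏ l ∈ Finset.range b, (1 - zetaRoot b α r l) := by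
  obtain ⟨c, hc⟩ := exists_eventually_genU_eq hb hα0 h0 h1 h
  have hs0 : 0 < s := one_pos.trans hs1
  have hgen := differentiableOn_genU h0 (h.measure_infiniteU_le hb h0 h1) hs0.le hρs
  have hroots : ∀ S : Finset ℕ, DifferentiableOn ℂ
      (fun r => ∏ l ∈ S, (1 - zetaRoot b α r l)) (Metric.ball 0 s) := fun S =>
    DifferentiableOn.fun_finsetProd fun l _ =>
      (differentiableOn_const 1).sub (differentiableOn_zetaRoot hα0 hs l)
  have hL : DifferentiableOn ℂ (fun r => (1 - r ^ b) * genU b α (r ^ b)) (Metric.ball 0 s) :=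
    DifferentiableOn.mul (by fun_prop) hgen
  -- Agreement in a punctured neighbourhood of `0` spreads over the whole disc.
  have heq := (hL.analyticOnNhd Metric.isOpen_ball).eqOn_of_preconnected_of_frequently_eq
    (((hroots (Finset.range b)).const_mul c).analyticOnNhd Metric.isOpen_ball)
    (convex_ball (0 : ℂ) s).isPreconnected (Metric.mem_ball_self hs0) hc.frequently
  have hmem : Metric.ball (0 : ℂ) s ∈ 𝓝 (1 : ℂ) :=
    Metric.isOpen_ball.mem_nhds (by simpa using hs1)
  set K : ℂ := ∏ l ∈ Finset.Ico 1 b, (1 - zetaRoot b α 1 l) with hK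
  -- Both sides vanish at `r = 1`, the right one through its factor `1 - ζ_0`. Their derivatives
  -- need only the value `1` of the generating function and the derivative `1 / (1 - α)` of `ζ_0`.
  have hdL : HasDerivAt (fun r => (1 - r ^ b) * genU b α (r ^ b)) (-(b : ℂ)) 1 := by
    have h2 : HasDerivAt (fun r : ℂ => 1 - r ^ b) (-(b : ℂ)) 1 := by
      simpa using (hasDerivAt_pow b (1 : ℂ)).const_sub 1
    have h3 := h2.mul ((hgen.differentiableAt hmem).hasDerivAt)
    convert! h3 using 1
    simp [genU_one hb]
  have hdR : HasDerivAt (fun r => c * ∏ l ∈ Finset.range b, (1 - zetaRoot b α r l))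
      (c * (-(1 / (1 - α)) * K)) 1 := by
    have h2 := (hasDerivAt_zetaRoot_zero (b := b) hα0 hα1).const_sub 1
    have h3 := (h2.mul (((hroots (Finset.Ico 1 b)).differentiableAt hmem).hasDerivAt)).const_mul c
    simp only [zetaRoot_one_zero hα0 hα1, sub_self, zero_mul, add_zero] at h3
    convert! h3 using 1
    funext r
    rw [Finset.prod_range_eq_mul_Ico _ (by omega)]; rfl
  have hder := hdL.unique (hdR.congr_of_eventuallyEq (eventually_of_mem hmem heq))
  have hne : (1 - (α : ℂ)) ≠ 0 := by
    rw [sub_ne_zero]; exact_mod_cast hα1.ne'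
  have hcK : c * K = b * (1 - α) := by
    field_simp at hder
    linear_combination hder
  have hb' : (b : ℂ) ≠ 0 := by exact_mod_cast (by omega : b ≠ 0)
  -- That no other `ζ_ℓ` equals `1` comes for free, since `c K = b (1 - α)` is nonzero.
  have hK0 : K ≠ 0 := by
    intro hK0
    rw [hK0, mul_zero] at hcK
    exact mul_ne_zero hb' hne hcK.symm
  have hct : c = tZero b α := by
    rw [tZero, ← hK, eq_div_iff hK0, hcK]
  rw [← hct]
  exact heq (by simpa using hr)

lemma pgf_eq_genU (hb : 1 ≤ b) {q : ℂ}
    (hq : Integrable (fun k : ℕ => q ^ k) ((poissonModel b α).map (infiniteU b))) :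
    pgf (poissonModel b α) (infiniteU b) q = genU b α q := by
  have h := integral_map (μ := poissonModel b α) (f := fun k : ℕ => q ^ k)
    (measurable_infiniteU hb).aemeasurable Measurable.of_discrete.aestronglyMeasurable
  rw [pgf, ← h, integral_countable hq, genU]
  exact tsum_congr fun k => by rw [Complex.real_smul, mul_comm]

end Global

/-! ### The limit theorem -/

lemma HasGeometricTail.mono {b : ℕ} {ρ ρ' : ℝ} {ν : Measure (ℤ → ℕ)} (h : HasGeometricTail b ρ ν)
    (h0 : 0 ≤ ρ) (hρ : ρ ≤ ρ') : HasGeometricTail b ρ' ν := fun i L =>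
  (h i L).trans (ENNReal.ofReal_le_ofReal (pow_le_pow_left₀ h0 hρ L))

/-- A common rate for the geometric tails of the Poisson model and of all exact models with
`n ≤ b β m`. -/
lemma exists_common_geometricTail {b : ℕ} (hb : 1 ≤ b) {α β : ℝ} (hα : 0 < α) (hαβ : α < β)
    (hβ : β < 1) : ∃ ρ : ℝ, 0 ≤ ρ ∧ ρ < 1 ∧ HasGeometricTail b ρ (poissonModel b α) ∧
      ∀ (m n : ℕ) [NeZero m], (n : ℝ) ≤ b * β * m → HasGeometricTail b ρ (periodicModel m n) := by
  have hβ0 : 0 < β := hα.trans hαβ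
  have hb0 : (0 : ℝ) < b := by exact_mod_cast hb
  -- The choice `t = -log β` minimises the Chernoff exponent `b β (exp t - 1) - t b`; the minimum is
  -- `b (1 - β + log β) < 0`.
  have ht : 0 ≤ -Real.log β := by
    have := Real.log_neg hβ0 hβ
    linarith
  have he : Real.exp (-Real.log β) = β⁻¹ := by rw [Real.exp_neg, Real.exp_log hβ0]
  refine ⟨Real.exp (b * β * (Real.exp (-Real.log β) - 1) - -Real.log β * b), (Real.exp_pos _).le,
    ?_, ?_, fun m n _ hn => hasGeometricTail_periodicModel ht hn⟩
  · rw [Real.exp_lt_one_iff, he]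
    have := Real.log_lt_sub_one_of_pos hβ0 hβ.ne
    have h2 : (b : ℝ) * β * (β⁻¹ - 1) - -Real.log β * b = b * (1 - β + Real.log β) := by
      field_simp
      ring
    rw [h2]
    exact mul_neg_of_pos_of_neg hb0 (by linarith)
  · refine (hasGeometricTail_poissonModel b hα.le ht).mono (Real.exp_pos _).le
      (Real.exp_le_exp.2 ?_)
    have : 0 ≤ Real.exp (-Real.log β) - 1 := by linarith [Real.add_one_le_exp (-Real.log β)]
    gcongr

lemma exists_radius (b : ℕ) {α ρ : ℝ} (hα0 : 0 < α) (hα1 : α < 1) (hρ : ρ < 1) :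
    ∃ s : ℝ, 1 < s ∧ s ≤ Real.exp (α - 1) / α ∧ ρ * s ^ b < 1 := by
  have h1 : 1 < Real.exp (α - 1) / α := by
    rw [one_lt_div hα0]
    have := Real.add_one_lt_exp (sub_ne_zero.2 hα1.ne)
    linarith
  have h2 : Tendsto (fun s : ℝ => ρ * s ^ b) (𝓝[>] 1) (𝓝 ρ) := by
    have : Continuous fun s : ℝ => ρ * s ^ b := by fun_prop
    simpa using (this.tendsto 1).mono_left nhdsWithin_le_nhds
  obtain ⟨s, hs1, hs2, hs3⟩ := (((tendsto_order.1 h2).2 1 hρ).and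
    (Ioo_mem_nhdsGT h1)).exists
  exact ⟨s, hs2, hs3.le, hs1⟩

lemma exists_pow_le_mul_pow (s : ℕ) {R : ℝ} (hR : 1 < R) :
    ∃ G : ℝ, ∀ k : ℕ, ‖(k : ℝ) ^ s‖ ≤ G * R ^ k := by
  obtain ⟨G, hG⟩ := (tendsto_pow_const_div_const_pow_of_one_lt s hR).bddAbove_range
  refine ⟨G, fun k => ?_⟩
  have := hG ⟨k, rfl⟩
  rw [Real.norm_of_nonneg (by positivity)]
  rwa [div_le_iff₀ (by positivity)] at this

lemma map_finiteU_eq {b m n : ℕ} [NeZero m] (hb : 1 ≤ b) (hn : n < b * m) :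
    (exactModel m n).map (finiteU b m n) = (periodicModel m n).map (infiniteU b) := by
  rw [periodicModel, Measure.map_map (measurable_infiniteU hb) measurable_periodicCount]
  congr 1
  funext h
  exact finiteU_eq hn h

theorem mainTheorem4 (b : ℕ) (hb : 1 ≤ b) (α : ℝ) (hα0 : 0 < α) (hα1 : α < 1) :
    -- almost surely, a search in the infinite table ends
    (∀ᵐ x ∂(poissonModel b α), ∃ k : ℕ, infiniteTable b x (0 + (k : ℤ)) < b) ∧
    ∃ δ : ℝ, 0 < δ ∧
      -- all `ζ_ℓ(q)` with `‖q‖ ≤ 1 + δ` are defined by convergent series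
      1 + δ ≤ (Real.exp (α - 1) / α) ^ b ∧
      -- the generating function of `U_α`, for every choice `r` of the root `q ^ (1/b)`
      (∀ q : ℂ, ‖q‖ ≤ 1 + δ →
        Integrable (fun x => q ^ infiniteU b x) (poissonModel b α) ∧
        ∀ r : ℂ, r ^ b = q → q ≠ 1 →
          pgf (poissonModel b α) (infiniteU b) q =
            tZero b α / (1 - q) * ∏ l ∈ Finset.range b, (1 - zetaRoot b α r l)) ∧
      -- all moments of `U_α` are finite
      (∀ s : ℕ, Integrable (fun x => (infiniteU b x : ℝ) ^ s) (poissonModel b α)) ∧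
      -- convergence of the exact model as `m, n → ∞` with `n / (b m) → α`
      ∀ (m n : ℕ → ℕ) [∀ k, NeZero (m k)],
        Tendsto m atTop atTop → Tendsto n atTop atTop →
        Tendsto (fun k => (n k : ℝ) / ((b : ℝ) * (m k : ℝ))) atTop (𝓝 α) →
          TendstoInDistribution (fun k => finiteU b (m k) (n k)) atTop (infiniteU b)
            (fun k => exactModel (m k) (n k)) (poissonModel b α) ∧
          (∀ s : ℕ,
            Tendsto (fun k => ∫ h, (finiteU b (m k) (n k) h : ℝ) ^ s ∂(exactModel (m k) (n k)))
              atTop (𝓝 (∫ x, (infiniteU b x : ℝ) ^ s ∂(poissonModel b α)))) ∧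
          TendstoUniformlyOn (fun k => pgf (exactModel (m k) (n k)) (finiteU b (m k) (n k)))
            (pgf (poissonModel b α) (infiniteU b)) atTop (Metric.closedBall 0 (1 + δ)) := by
  -- Any `β` strictly between `α` and `1` serves: eventually `n ≤ b β m`, so one rate `ρ` covers the
  -- limit and all late exact models.
  have hαβ : α < (1 + α) / 2 := by linarith
  have hβ1 : (1 + α) / 2 < 1 := by linarith
  obtain ⟨ρ, h0, h1, htail, htails⟩ := exists_common_geometricTail hb hα0 hαβ hβ1
  obtain ⟨s, hs1, hs, hρs⟩ := exists_radius b hα0 hα1 h1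
  have hsb : 1 < s ^ b := one_lt_pow₀ hs1 (by omega)
  have hU := measurable_infiniteU hb
  have hlaw := htail.measure_infiniteU_le hb h0 h1
  -- Half of the available room is used, so that `R = 1 + δ` is strictly below `s ^ b`: roots of `q`
  -- then lie in the open disc of radius `s`, and `ρ R < 1`.
  refine ⟨?_, (s ^ b - 1) / 2, by linarith, ?_, ?_⟩
  · filter_upwards [htail.ae_exists_not_isFull h0 h1] with x ⟨k, hk⟩
    exact ⟨k, by rwa [infiniteTable_lt_iff hb, zero_add]⟩
  · have : s ^ b ≤ (Real.exp (α - 1) / α) ^ b := pow_le_pow_left₀ (by linarith) hs b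
    linarith
  set R : ℝ := 1 + (s ^ b - 1) / 2 with hR
  have hR1 : 1 < R := by linarith
  have hRs : R < s ^ b := by linarith
  have hR0 : 0 ≤ R := by linarith
  have hρR : ρ * R < 1 := (mul_le_mul_of_nonneg_left hRs.le h0).trans_lt hρs
  have hpow : ∀ q : ℂ, ‖q‖ ≤ R → ∀ k : ℕ, ‖q ^ k‖ ≤ 1 * R ^ k := fun q hq k => by
    rw [norm_pow, one_mul]; exact pow_le_pow_left₀ (norm_nonneg _) hq k
  refine ⟨fun q hq => ⟨?_, fun r hr hq1 => ?_⟩, fun p => ?_, fun m n _ hm _ hmn => ?_⟩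
  · exact (integrable_of_geometric_tail hlaw h0 hR0 hρR (hpow q hq)).comp_measurable hU
  · rw [pgf_eq_genU hb (integrable_of_geometric_tail hlaw h0 hR0 hρR (hpow q hq))]
    have hrs : ‖r‖ < s := by
      refine lt_of_pow_lt_pow_left₀ b (by linarith) ?_
      rw [← norm_pow, hr]
      exact hq.trans_lt hRs
    have h := one_sub_mul_genU hb hα0 hα1 h0 h1 htail hs1 hs hρs hrs
    rw [hr] at h
    rw [div_mul_eq_mul_div, eq_div_iff (sub_ne_zero.2 hq1.symm), ← h, mul_comm]
  · obtain ⟨G, hG⟩ := exists_pow_le_mul_pow p hR1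
    exact (integrable_of_geometric_tail hlaw h0 hR0 hρR hG).comp_measurable hU
  have hle : ∀ᶠ k in atTop, (n k : ℝ) ≤ b * ((1 + α) / 2) * m k := by
    filter_upwards [(tendsto_order.1 hmn).2 _ hαβ] with k hk
    have hmk : (0 : ℝ) < m k := by exact_mod_cast NeZero.pos (m k)
    have hb0 : (0 : ℝ) < b := by exact_mod_cast hb
    rw [div_lt_iff₀ (by positivity)] at hk
    linarith
  have hmap : ∀ᶠ k in atTop, (exactModel (m k) (n k)).map (finiteU b (m k) (n k))
      = (periodicModel (m k) (n k)).map (infiniteU b) := by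
    filter_upwards [hle] with k hk
    have hmk : (0 : ℝ) < m k := by exact_mod_cast NeZero.pos (m k)
    have hb0 : (0 : ℝ) < b := by exact_mod_cast hb
    refine map_finiteU_eq hb ?_
    have : (n k : ℝ) < b * m k := by
      refine hk.trans_lt ?_
      rw [mul_assoc]
      gcongr
      nlinarith
    exact_mod_cast this
  have htails' : ∀ᶠ k in atTop, HasGeometricTail b ρ (periodicModel (m k) (n k)) :=
    hle.mono fun k hk => htails _ _ hk
  have hlaws := htails'.mono fun k hk => hk.measure_infiniteU_le hb h0 h1
  have hlim := tendsto_tsum_abs_sub hlaws hlaw h0 hR0 hρR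
    (tendsto_map_infiniteU hb h0 h1 htails' htail
      (tendsto_periodicModel_preimage_restrict hb hα0.le hm hmn))
  have hfin : ∀ {E : Type} [NormedAddCommGroup E] [NormedSpace ℝ E] (k : ℕ) (g : ℕ → E),
      ∫ h, g (finiteU b (m k) (n k) h) ∂(exactModel (m k) (n k))
        = ∫ j, g j ∂((exactModel (m k) (n k)).map (finiteU b (m k) (n k))) := fun k g =>
    (integral_map Measurable.of_discrete.aemeasurable
      StronglyMeasurable.of_discrete.aestronglyMeasurable).symm
  have hinf : ∀ {E : Type} [NormedAddCommGroup E] [NormedSpace ℝ E] (g : ℕ → E),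
      ∫ x, g (infiniteU b x) ∂(poissonModel b α)
        = ∫ j, g j ∂((poissonModel b α).map (infiniteU b)) := fun g =>
    (integral_map hU.aemeasurable StronglyMeasurable.of_discrete.aestronglyMeasurable).symm
  have hbound : ∀ᶠ k in atTop, ∀ {E : Type} [NormedAddCommGroup E] [NormedSpace ℝ E]
      [CompleteSpace E] (G : ℝ) (g : ℕ → E), (∀ j, ‖g j‖ ≤ G * R ^ j) →
      ‖∫ j, g j ∂((exactModel (m k) (n k)).map (finiteU b (m k) (n k)))
          - ∫ j, g j ∂((poissonModel b α).map (infiniteU b))‖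
        ≤ G * ∑' j, |((periodicModel (m k) (n k)).map (infiniteU b)).real {j}
          - ((poissonModel b α).map (infiniteU b)).real {j}| * R ^ j := by
    filter_upwards [hmap, hlaws] with k hk hk' E _ _ _ G g hg
    rw [hk]
    exact norm_integral_sub_le hk' hlaw h0 hR0 hρR hg
  have hconv : ∀ {E : Type} [NormedAddCommGroup E] [NormedSpace ℝ E]
      [CompleteSpace E] (G : ℝ) (g : ℕ → E), (∀ j, ‖g j‖ ≤ G * R ^ j) →
      Tendsto (fun k => ∫ j, g j ∂((exactModel (m k) (n k)).map (finiteU b (m k) (n k)))) atTop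
        (𝓝 (∫ j, g j ∂((poissonModel b α).map (infiniteU b)))) := by
    intro E _ _ _ G g hg
    rw [tendsto_iff_norm_sub_tendsto_zero]
    refine squeeze_zero' (Eventually.of_forall fun k => norm_nonneg _) (hbound.mono fun k hk =>
      hk G g hg) ?_
    simpa using hlim.const_mul G
  refine ⟨⟨fun k => Measurable.of_discrete.aemeasurable, hU.aemeasurable, ?_⟩, fun p => ?_, ?_⟩
  · refine ProbabilityMeasure.tendsto_iff_forall_integral_tendsto.2 fun f => ?_
    -- A bounded function is admissible because `R ^ j ≥ 1`.
    refine hconv ‖f‖ f fun j => (f.norm_coe_le_norm j).trans ?_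
    exact le_mul_of_one_le_right (norm_nonneg _) (one_le_pow₀ hR1.le)
  · obtain ⟨G, hG⟩ := exists_pow_le_mul_pow p hR1
    have h := hconv G _ hG
    rw [← hinf] at h
    exact h.congr fun k => (hfin k fun j => (j : ℝ) ^ p).symm
  · rw [Metric.tendstoUniformlyOn_iff]
    intro ε hε
    filter_upwards [hbound, (tendsto_order.1 hlim).2 ε hε] with k hk hkε q hq
    rw [dist_comm, dist_eq_norm, pgf, pgf, hfin k fun j => q ^ j, hinf fun j => q ^ j]
    refine (hk 1 _ (hpow q (by simpa using hq))).trans_lt ?_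
    rwa [one_mul]
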